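/- Let $d\ge 1$ be an integer. For $\lambda>0$ and a probability measure $\nu$ on $]0,+\infty[$, let $\xi$ be a Poisson point process on $\mathbb{R}^d\times]0,+\infty[$ whose intensity measure is the product of $\lambda$ times Lebesgue measure on $\mathbb{R}^d$ and $\nu$; write $P_{\lambda,\nu}$ for the associated probability measure. Let $$\Sigma=\bigcup_{(c,r)\in\xi}B(c,r),$$ where $B(c,r)$ is the open Euclidean ball with centre $c$ and radius $r$, and let $S$ be the connected component of $\Sigma$ that contains $0$ ($S=\emptyset$ if $0\notin\Sigma$). Percolation is the event that $S$ is unbounded. Theorem 2.1. For all probability measures $\nu$ on $]0,+\infty[$, the following assertions are equivalent: 1. the moment $\int r^d\,\nu(dr)$ is finite; 2. there exists $\lambda_0>0$ such that $P_{\lambda,\nu}(\text{Percolation})=0$ for all positive real $\lambda<\lambda_0$. Moreover, there exists a positive constant $C$ that depends only on the dimension $d$ such that, for all probability measures $\nu$ on $]0,+\infty[$, if the previous assertions hold, then $$P_{\lambda,\nu}(\text{Percolation})=0\quad\text{for all positive real }\lambda<C\left(\int r^d\,\nu(dr)\right)^{-1}.$$ -/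

import Mathlib

open MeasureTheory ProbabilityTheory

universe u

/-- `ξ` is a Poisson point process on `X` with intensity measure `μ`, defined on the probability
space `(Ω, P)` and viewed as a random set of points: the number of points in each measurable set
is a random variable, which is Poisson distributed with mean `μ B` when `μ B < ∞`, and the numbers
of points in pairwise disjoint measurable sets are independent. -/
structure IsPoissonPointProcess {X : Type*} [MeasurableSpace X] {Ω : Type*} [MeasurableSpace Ω]
    (μ : Measure X) (P : Measure Ω) (ξ : Ω → Set X) : Prop where
  measurable_count : ∀ B : Set X, MeasurableSet B → Measurable fun ω => (ξ ω ∩ B).encard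
  poisson_count : ∀ B : Set X, MeasurableSet B → μ B < ⊤ →
    HasLaw (fun ω => (ξ ω ∩ B).encard)
      ((poissonMeasure (μ B).toNNReal).map (fun n : ℕ => (n : ℕ∞))) P
  indep_count : ∀ (n : ℕ) (B : Fin n → Set X), (∀ i, MeasurableSet (B i)) →
    Pairwise (fun i j => Disjoint (B i) (B j)) →
    iIndepFun (fun i ω => (ξ ω ∩ B i).encard) P

namespace BooleanModel

/-- The Euclidean space `ℝ^d`. -/
abbrev Space (d : ℕ) : Type := EuclideanSpace ℝ (Fin d)

/-- The set of admissible radii, `]0, +∞[`. -/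
abbrev Radius : Type := Set.Ioi (0 : ℝ)

/-- The intensity measure: the product of `lam` times Lebesgue measure on `ℝ^d` with `ν`. -/
noncomputable def intensity (d : ℕ) (lam : ℝ) (ν : Measure Radius) :
    Measure (Space d × Radius) :=
  (ENNReal.ofReal lam • (volume : Measure (Space d))).prod ν

/-- The occupied set `Σ` of a configuration of (centre, radius) pairs: the union of the
corresponding open balls. -/
def occupied {d : ℕ} (ξ : Set (Space d × Radius)) : Set (Space d) :=
  ⋃ p ∈ ξ, Metric.ball p.1 (p.2 : ℝ)

/-- The cluster `S` of the origin: the connected component of `Σ` containing `0`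
(the empty set if `0 ∉ Σ`). -/
noncomputable def cluster {d : ℕ} (ξ : Set (Space d × Radius)) : Set (Space d) :=
  connectedComponentIn (occupied ξ) 0

/-- Percolation occurs in a configuration if the cluster of the origin is unbounded. -/
def Percolates {d : ℕ} (ξ : Set (Space d × Radius)) : Prop :=
  ¬ Bornology.IsBounded (cluster ξ)

/-- The percolation probability of the Poisson Boolean model on `ℝ^d` with density `lam` and
radius law `ν` vanishes. The event only depends on the law of the driving Poisson process, so
the process is allowed to be any realization, on any probability space. -/
def PercolationNull (d : ℕ) (lam : ℝ) (ν : Measure Radius) : Prop :=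
  ∀ (Ω : Type u) [MeasurableSpace Ω] (P : Measure Ω) [IsProbabilityMeasure P]
    (ξ : Ω → Set (Space d × Radius)),
    IsPoissonPointProcess (intensity d lam ν) P ξ → P {ω | Percolates (ξ ω)} = 0

end BooleanModel

/-!
Why percolation occurs with probability zero at small density exactly when the `d`-th moment of the
radius is finite.

*Finite moment.* Any point of the cluster of the origin is joined to the origin by a finite chain of
balls (`exists_isBallChain_of_mem_cluster`), so percolation can be studied through the crossing
events `Crosses ξ x a`: a chain of balls with centres in `B(x, 10a)` leads from `B(x, a)` to the
outside of the ball of radius `8a` around `x`. If no ball with centre in `B(x, 100a)` has radius at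
least `a`, a crossing at scale `10a` moves by short steps and contains two crossings at scale `a`,
one near its start and one near its end; their positions can be taken from a finite net
(`Crosses.exists_pair`). Crossings at scale `a` around points at distance at least `20a` depend on
the process in disjoint regions and are independent (`indep_voidAlgebra`). Hence the largest
probability `π(a)` of a crossing at scale `a` satisfies
`π(10a) ≤ K π(a)² + K λ ∫_{r ≥ a} r ^ d ν(dr)`, see `crossingProb_ten_mul_le`. Moreover `π(a)` is
small for small `a`, whatever `λ`, since a crossing needs a centre in `B(x, 10a)`. If `λ ∫ r ^ d dν`
is smaller than a constant that depends only on `K`, the recursion started at a small scale forces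
`π` to vanish along the scales `10 ^ n a` (`tendsto_zero_of_le_add_sq`). Percolation implies a
crossing around the origin or the presence of a large ball (`Percolates.crosses_or`), and both have
small probability at large scales.

*Infinite moment.* The mean number of balls that contain a given ball around the origin is then
infinite, so almost surely all these balls are covered and the cluster is the whole space. For this
to contradict `PercolationNull`, the Poisson process has to exist
(`exists_isPoissonPointProcess`). It is built from independent finite families of points, a Poisson
number of independent points for each term of a decomposition of the intensity into finite
measures; independence and the laws of the counts are read off the joint characteristic function
(`IsPoissonSample.integral_exp_ncard`).
-/

open Filter Topology
open scoped ENNReal NNReal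

/-! ### Void events of a Poisson point process -/

namespace IsPoissonPointProcess

lemma setOf_void_eq {X Ω : Type*} (ξ : Ω → Set X) (B : Set X) :
    {ω | ξ ω ∩ B = ∅} = (fun ω => (ξ ω ∩ B).encard) ⁻¹' {0} := by
  ext ω; simp

variable {X : Type*} [MeasurableSpace X] {Ω : Type*} [MeasurableSpace Ω]
  {μ : Measure X} {P : Measure Ω} {ξ : Ω → Set X}

lemma measurableSet_void (h : IsPoissonPointProcess μ P ξ) {B : Set X} (hB : MeasurableSet B) :
    MeasurableSet {ω | ξ ω ∩ B = ∅} := by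
  rw [setOf_void_eq]
  exact h.measurable_count B hB (measurableSet_singleton 0)

lemma measure_void (h : IsPoissonPointProcess μ P ξ) {B : Set X} (hB : MeasurableSet B)
    (hfin : μ B < ⊤) :
    P {ω | ξ ω ∩ B = ∅} = ENNReal.ofReal (Real.exp (-(μ B).toReal)) := by
  have hl := h.poisson_count B hB hfin
  rw [setOf_void_eq, ← Measure.map_apply_of_aemeasurable hl.aemeasurable (measurableSet_singleton 0),
    hl.map_eq, Measure.map_apply .of_discrete (measurableSet_singleton 0)]
  have : (fun n : ℕ => (n : ℕ∞)) ⁻¹' {0} = {0} := by ext; simp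
  rw [this, poissonMeasure_singleton]
  simp [ENNReal.coe_toNNReal_eq_toReal]

lemma measure_hit_le [IsProbabilityMeasure P] (h : IsPoissonPointProcess μ P ξ) {B : Set X}
    (hB : MeasurableSet B) : P {ω | (ξ ω ∩ B).Nonempty} ≤ μ B := by
  rcases eq_or_ne (μ B) ⊤ with htop | hfin
  · rw [htop]; exact le_top
  have hc : {ω | (ξ ω ∩ B).Nonempty} = {ω | ξ ω ∩ B = ∅}ᶜ := by
    ext ω; simp [Set.nonempty_iff_ne_empty]
  rw [hc, prob_compl_eq_one_sub (h.measurableSet_void hB), h.measure_void hB hfin.lt_top,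
    ← ENNReal.ofReal_one, ← ENNReal.ofReal_sub _ (Real.exp_pos _).le,
    ← ENNReal.ofReal_toReal hfin]
  apply ENNReal.ofReal_le_ofReal
  rw [ENNReal.toReal_ofReal ENNReal.toReal_nonneg]
  linarith [Real.add_one_le_exp (-(μ B).toReal)]

end IsPoissonPointProcess

/-- The `σ`-algebra generated by the events that a measurable subset of `D` contains no point
of `ξ`. -/
@[reducible]
def voidAlgebra {X : Type*} [MeasurableSpace X] {Ω : Type*} (ξ : Ω → Set X) (D : Set X) :
    MeasurableSpace Ω :=
  MeasurableSpace.generateFrom {s | ∃ B ⊆ D, MeasurableSet B ∧ s = {ω | ξ ω ∩ B = ∅}}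

namespace IsPoissonPointProcess

lemma isPiSystem_void {X : Type*} [MeasurableSpace X] {Ω : Type*} (ξ : Ω → Set X) (D : Set X) :
    IsPiSystem {s | ∃ B ⊆ D, MeasurableSet B ∧ s = {ω | ξ ω ∩ B = ∅}} := by
  rintro _ ⟨B, hBD, hB, rfl⟩ _ ⟨C, hCD, hC, rfl⟩ -
  refine ⟨B ∪ C, Set.union_subset hBD hCD, hB.union hC, ?_⟩
  ext ω
  simp [Set.inter_union_distrib_left, Set.union_empty_iff]

variable {X : Type*} [MeasurableSpace X] {Ω : Type*} [MeasurableSpace Ω]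
  {μ : Measure X} {P : Measure Ω} {ξ : Ω → Set X}

lemma voidAlgebra_le (h : IsPoissonPointProcess μ P ξ) (D : Set X) :
    voidAlgebra ξ D ≤ ‹MeasurableSpace Ω› := by
  refine MeasurableSpace.generateFrom_le ?_
  rintro _ ⟨B, -, hB, rfl⟩
  exact h.measurableSet_void hB

/-- What a Poisson process does in disjoint regions is independent. The void events form a
`π`-system, so independence of the counts in pairs of disjoint sets is enough. -/
lemma indep_voidAlgebra [IsProbabilityMeasure P] (h : IsPoissonPointProcess μ P ξ) {D E : Set X}
    (hDE : Disjoint D E) : Indep (voidAlgebra ξ D) (voidAlgebra ξ E) P := by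
  refine IndepSets.indep (h.voidAlgebra_le D) (h.voidAlgebra_le E) (isPiSystem_void ξ D)
    (isPiSystem_void ξ E) rfl rfl ?_
  rw [IndepSets_iff]
  rintro _ _ ⟨B, hBD, hB, rfl⟩ ⟨C, hCE, hC, rfl⟩
  have hBC : Disjoint B C := hDE.mono hBD hCE
  have hi := h.indep_count 2 ![B, C] (by simp [Fin.forall_fin_two, hB, hC]) (by
    intro i j hij
    fin_cases i <;> fin_cases j <;> simp_all [disjoint_comm])
  have h2 := (hi.indepFun (i := 0) (j := 1) (by simp)).measure_inter_preimage_eq_mul {0} {0}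
    (measurableSet_singleton 0) (measurableSet_singleton 0)
  rw [setOf_void_eq, setOf_void_eq]
  exact h2

end IsPoissonPointProcess

namespace IsPoissonPointProcess

variable {X : Type*} [MeasurableSpace X] {Ω : Type*} {ξ : Ω → Set X}

lemma measurableSet_voidAlgebra_hit {D B : Set X} (hBD : B ⊆ D) (hB : MeasurableSet B) :
    MeasurableSet[voidAlgebra ξ D] {ω | (ξ ω ∩ B).Nonempty} := by
  have hc : {ω | (ξ ω ∩ B).Nonempty} = {ω | ξ ω ∩ B = ∅}ᶜ := by
    ext ω; simp [Set.nonempty_iff_ne_empty]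
  rw [hc]
  refine MeasurableSet.compl ?_
  exact MeasurableSpace.measurableSet_generateFrom ⟨B, hBD, hB, rfl⟩

/-- An open condition on finite tuples of points of `ξ` in `D` is measurable: by second
countability it is a countable union of finite intersections of hitting events. -/
lemma measurableSet_exists_tuple [TopologicalSpace X] [SecondCountableTopology X]
    [OpensMeasurableSpace X] (ξ : Ω → Set X) {D : Set X} (hD : IsOpen D) {n : ℕ}
    {O : Set (Fin n → X)} (hO : IsOpen O) :
    MeasurableSet[voidAlgebra ξ D] {ω | ∃ p ∈ O, ∀ i, p i ∈ ξ ω ∧ p i ∈ D} := by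
  classical
  set b := TopologicalSpace.countableBasis X
  have hb := TopologicalSpace.isBasis_countableBasis X
  have : Countable b := (TopologicalSpace.countable_countableBasis X).to_subtype
  have heq : {ω | ∃ p ∈ O, ∀ i, p i ∈ ξ ω ∧ p i ∈ D} =
      ⋃ s : {s : Fin n → b // Set.univ.pi (fun i => (s i : Set X)) ⊆ O},
        ⋂ i, {ω | (ξ ω ∩ ((s.1 i : Set X) ∩ D)).Nonempty} := by
    ext ω
    simp only [Set.mem_ofPred_eq, Set.mem_iUnion, Set.mem_iInter]
    constructor
    · rintro ⟨p, hpO, hp⟩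
      obtain ⟨u, hu, hsub⟩ := isOpen_pi_iff'.1 hO p hpO
      choose v hvb hpv hvu using fun i => hb.exists_subset_of_mem_open (hu i).2 (hu i).1
      exact ⟨⟨fun i => ⟨v i, hvb i⟩, (Set.pi_mono fun i _ => hvu i).trans hsub⟩,
        fun i => ⟨p i, (hp i).1, hpv i, (hp i).2⟩⟩
    · rintro ⟨s, hs⟩
      choose p hp using hs
      exact ⟨p, s.2 fun i _ => (hp i).2.1, fun i => ⟨(hp i).1, (hp i).2.2⟩⟩
  rw [heq]
  refine MeasurableSet.iUnion fun s => MeasurableSet.iInter fun i => ?_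
  exact measurableSet_voidAlgebra_hit Set.inter_subset_right
    (((hb.isOpen (s.1 i).2).inter hD).measurableSet)

end IsPoissonPointProcess

/-! ### Chains of balls and crossings -/

namespace BooleanModel

variable {d : ℕ} {ξ : Set (Space d × Radius)} {p q : ℕ → Space d × Radius} {n : ℕ} {a : ℝ}
  {x y : Space d}

/-- `p 0, …, p n` are points of `ξ` whose consecutive balls meet; the values of `p` beyond `n`
are irrelevant. -/
structure IsBallChain (ξ : Set (Space d × Radius)) (p : ℕ → Space d × Radius) (n : ℕ) : Prop where
  mem : ∀ i ≤ n, p i ∈ ξ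
  adj : ∀ i < n, dist (p i).1 (p (i + 1)).1 < (p i).2 + (p (i + 1)).2

lemma IsBallChain.take (h : IsBallChain ξ p n) {m : ℕ} (hm : m ≤ n) : IsBallChain ξ p m :=
  ⟨fun i hi => h.mem i (hi.trans hm), fun i hi => h.adj i (hi.trans_le hm)⟩

lemma IsBallChain.reverse (h : IsBallChain ξ p n) : IsBallChain ξ (fun i => p (n - i)) n := by
  refine ⟨fun i _ => h.mem _ (n.sub_le i), fun i hi => ?_⟩
  have := h.adj (n - (i + 1)) (by omega)
  rw [show n - (i + 1) + 1 = n - i by omega] at this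
  rw [dist_comm]
  linarith

lemma IsBallChain.snoc (h : IsBallChain ξ p n) {c : Space d × Radius} (hc : c ∈ ξ)
    (hadj : dist (p n).1 c.1 < (p n).2 + c.2) :
    IsBallChain ξ (fun i => if i ≤ n then p i else c) (n + 1) := by
  refine ⟨fun i hi => ?_, fun i hi => ?_⟩
  · by_cases h' : i ≤ n
    · simpa [h'] using h.mem i h'
    · simpa [h'] using hc
  · rcases Nat.lt_succ_iff_lt_or_eq.1 hi with h' | rfl
    · simpa [h'.le, Nat.succ_le_of_lt h'] using h.adj i h'
    · simpa using hadj

/-- Any point of the cluster of the origin is joined to it by a finite chain of balls. -/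
lemma exists_isBallChain_of_mem_cluster (hy : y ∈ cluster ξ) :
    ∃ n p, IsBallChain ξ p n ∧ dist (p 0).1 0 < (p 0).2 ∧ dist (p n).1 y < (p n).2 := by
  set T : Set (Space d) :=
    {y | ∃ n p, IsBallChain ξ p n ∧ dist (p 0).1 0 < (p 0).2 ∧ dist (p n).1 y < (p n).2} with hT
  -- the balls that cannot be reached cover the rest of the occupied set
  set U : Set (Space d) :=
    ⋃ c ∈ {c ∈ ξ | Disjoint (Metric.ball c.1 (c.2 : ℝ)) T}, Metric.ball c.1 (c.2 : ℝ) with hU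
  have hTo : IsOpen T := by
    rw [Metric.isOpen_iff]
    rintro y ⟨n, p, hp, h0, hn⟩
    refine ⟨(p n).2 - dist (p n).1 y, by linarith, fun z hz => ⟨n, p, hp, h0, ?_⟩⟩
    rw [Metric.mem_ball] at hz
    linarith [dist_triangle_right (p n).1 z y, dist_comm z y]
  have hUo : IsOpen U := isOpen_biUnion fun _ _ => Metric.isOpen_ball
  have hTU : Disjoint T U := by
    rw [hU, Set.disjoint_iUnion₂_right]
    exact fun c hc => hc.2.symm
  have h0S : (0 : Space d) ∈ occupied ξ := by
    by_contra h0
    simp [cluster, connectedComponentIn_eq_empty h0] at hy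
  have hcov : cluster ξ ⊆ T ∪ U := by
    refine (connectedComponentIn_subset _ _).trans fun z hz => ?_
    obtain ⟨c, hc, hzc⟩ := Set.mem_iUnion₂.1 hz
    by_cases hd : Disjoint (Metric.ball c.1 (c.2 : ℝ)) T
    · exact Or.inr (Set.mem_iUnion₂.2 ⟨c, ⟨hc, hd⟩, hzc⟩)
    · left
      obtain ⟨w, hwc, n, p, hp, h0, hn⟩ := Set.not_disjoint_iff.1 hd
      rw [Metric.mem_ball] at hwc hzc
      refine ⟨n + 1, _, hp.snoc hc ?_, by simpa using h0, ?_⟩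
      · linarith [dist_triangle (p n).1 w c.1]
      · simpa [dist_comm] using hzc
  have h0T : (0 : Space d) ∈ T := by
    obtain ⟨c, hc, hzc⟩ := Set.mem_iUnion₂.1 h0S
    rw [Metric.mem_ball, dist_comm] at hzc
    exact ⟨0, fun _ => c, ⟨fun _ _ => hc, fun i hi => absurd hi (Nat.not_lt_zero i)⟩, hzc, hzc⟩
  exact isPreconnected_connectedComponentIn.subset_left_of_subset_union hTo hUo hTU hcov
    ⟨0, mem_connectedComponentIn h0S, h0T⟩ hy

/-- The local crossing event at scale `a` around `x`: a chain of balls with centres in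
`B(x, 10a)` leads from `B(x, a)` to the outside of the closed ball of radius `8a` around `x`. -/
def Crosses (ξ : Set (Space d × Radius)) (x : Space d) (a : ℝ) : Prop :=
  ∃ n p, IsBallChain ξ p n ∧ (∀ i ≤ n, dist (p i).1 x < 10 * a) ∧
    dist (p 0).1 x < (p 0).2 + a ∧ 8 * a < dist (p n).1 x + (p n).2

/-- A chain that starts near `x` and gets far away has a first ball that leaves `B(x, 8a)`; the
chain up to this ball realises the crossing event unless the centre of this ball is far away. -/
lemma IsBallChain.exists_first (h : IsBallChain ξ p n) (h0 : dist (p 0).1 x < (p 0).2 + a)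
    (hn : 8 * a < dist (p n).1 x + (p n).2) (ha : 0 ≤ a) :
    ∃ m ≤ n, 8 * a < dist (p m).1 x + (p m).2 ∧
      (∀ i < m, dist (p i).1 x + (p i).2 ≤ 8 * a) ∧ dist (p m).1 x < (p m).2 + 8 * a := by
  classical
  have hex : ∃ m, 8 * a < dist (p m).1 x + (p m).2 := ⟨n, hn⟩
  refine ⟨Nat.find hex, Nat.find_min' hex hn, Nat.find_spec hex,
    fun i hi => not_lt.1 (Nat.find_min hex hi), ?_⟩
  have hmn := Nat.find_min' hex hn
  generalize hm : Nat.find hex = m at hmn ⊢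
  cases m with
  | zero => linarith
  | succ k =>
    have h1 := h.adj k (by omega)
    have h2 : dist (p k).1 x + (p k).2 ≤ 8 * a := not_lt.1 (Nat.find_min hex (by omega))
    linarith [dist_triangle_left (p (k + 1)).1 x (p k).1]

/-- If all the radii are smaller than `a`, a chain from near `x` to far away from `x` cannot jump
out of `B(x, 10a)`, hence realises the crossing event. -/
lemma IsBallChain.crosses (h : IsBallChain ξ p n) (hr : ∀ i ≤ n, ((p i).2 : ℝ) < a)
    (h0 : dist (p 0).1 x < (p 0).2 + a) (hn : 8 * a < dist (p n).1 x + (p n).2) :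
    Crosses ξ x a := by
  have ha : 0 < a := lt_trans (p 0).2.2 (hr 0 n.zero_le)
  obtain ⟨m, hmn, hm, hlt, hm'⟩ := h.exists_first h0 hn ha.le
  refine ⟨m, p, h.take hmn, fun i hi => ?_, h0, hm⟩
  rcases hi.lt_or_eq with hi | rfl
  · have h1 := hlt i hi
    have h2 : (0 : ℝ) < (p i).2 := (p i).2.2
    linarith
  · linarith [hr i hmn]

/-- The cluster of the origin can be unbounded only if the origin is crossed at every scale, or
if some ball with a far away centre is large. -/
lemma Percolates.crosses_or (h : Percolates ξ) (ha : 0 < a) :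
    Crosses ξ 0 a ∨ ∃ c ∈ ξ, 10 * a ≤ dist c.1 0 ∧ dist c.1 0 < c.2 + 8 * a := by
  have hex : ∃ y ∈ cluster ξ, 8 * a < dist y 0 := by
    by_contra! hcon
    exact h (Metric.isBounded_closedBall.subset fun y hy => Metric.mem_closedBall.2 (hcon y hy))
  obtain ⟨y, hy, hya⟩ := hex
  obtain ⟨n, p, hp, h0, hn⟩ := exists_isBallChain_of_mem_cluster hy
  obtain ⟨m, hmn, hm, hlt, hm'⟩ := hp.exists_first (x := 0) (a := a) (by linarith)
    (by linarith [dist_triangle_left y 0 (p n).1]) ha.le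
  by_cases hc : 10 * a ≤ dist (p m).1 0
  · exact Or.inr ⟨p m, hp.mem m hmn, hc, hm'⟩
  · refine Or.inl ⟨m, p, hp.take hmn, fun i hi => ?_, by linarith, hm⟩
    rcases hi.lt_or_eq with hi | rfl
    · have h1 := hlt i hi
      have h2 : (0 : ℝ) < (p i).2 := (p i).2.2
      linarith
    · exact not_le.1 hc

/-- A crossing at scale `10a` with small balls produces two crossings at scale `a`, one near the
start of the chain and one near its end. Here `t` is a net of the ball of radius `100`. -/
lemma Crosses.exists_pair {t : Set (Space d)}
    (ht : Metric.closedBall (0 : Space d) 100 ⊆ ⋃ k ∈ t, Metric.ball k 1) (ha : 0 < a)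
    (h : Crosses ξ x (10 * a)) (hr : ∀ c ∈ ξ, dist c.1 x < 100 * a → (c.2 : ℝ) < a) :
    ∃ k ∈ t, ∃ l ∈ t, 20 ≤ dist k l ∧ Crosses ξ (x + a • k) a ∧ Crosses ξ (x + a • l) a := by
  obtain ⟨n, p, hp, hD, h0, hn⟩ := h
  have hD' : ∀ i ≤ n, dist (p i).1 x < 100 * a := fun i hi => by linarith [hD i hi]
  have hrad : ∀ i ≤ n, ((p i).2 : ℝ) < a := fun i hi => hr _ (hp.mem i hi) (hD' i hi)
  have hnet : ∀ c : Space d, dist c x < 100 * a → ∃ k ∈ t, dist c (x + a • k) < a := by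
    intro c hc
    have hmem : a⁻¹ • (c - x) ∈ Metric.closedBall (0 : Space d) 100 := by
      rw [mem_closedBall_zero_iff, norm_smul, Real.norm_of_nonneg (inv_nonneg.2 ha.le),
        ← dist_eq_norm, inv_mul_le_iff₀ ha]
      linarith
    obtain ⟨k, hk, hck⟩ := Set.mem_iUnion₂.1 (ht hmem)
    refine ⟨k, hk, ?_⟩
    rw [Metric.mem_ball, dist_eq_norm] at hck
    have he : c - (x + a • k) = a • (a⁻¹ • (c - x) - k) := by
      rw [smul_sub, smul_inv_smul₀ ha.ne']; abel
    rw [dist_eq_norm, he, norm_smul, Real.norm_of_nonneg ha.le]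
    nlinarith
  obtain ⟨k, hk, hk'⟩ := hnet _ (hD' 0 n.zero_le)
  obtain ⟨l, hl, hl'⟩ := hnet _ (hD' n le_rfl)
  have h0r := hrad 0 n.zero_le
  have hnr := hrad n le_rfl
  have h0p : (0 : ℝ) < (p 0).2 := (p 0).2.2
  have hnp : (0 : ℝ) < (p n).2 := (p n).2.2
  -- the ends are far apart: `79 - 11 = 68`, since all radii are below `a`
  have hfar : 68 * a ≤ dist (p 0).1 (p n).1 := by
    linarith [dist_triangle_left (p n).1 x (p 0).1]
  refine ⟨k, hk, l, hl, ?_, hp.crosses hrad (by linarith) ?_, hp.reverse.crosses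
    (fun i _ => hrad _ (n.sub_le i)) (by simpa using by linarith) ?_⟩
  · have h1 : dist (x + a • k) (x + a • l) = a * dist k l := by
      rw [dist_add_left, dist_smul₀, Real.norm_of_nonneg ha.le]
    have h2 := dist_triangle4 (p 0).1 (x + a • k) (x + a • l) (p n).1
    rw [dist_comm (x + a • l)] at h2
    by_contra! hlt
    nlinarith
  · linarith [dist_triangle (p 0).1 (x + a • k) (p n).1, dist_comm (x + a • k) (p n).1]
  · simp only [Nat.sub_self]
    linarith [dist_triangle (p 0).1 (x + a • l) (p n).1, dist_comm (x + a • l) (p n).1]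

end BooleanModel

/-! ### Crossing probabilities and the subcritical regime -/

namespace BooleanModel

variable {d : ℕ}

lemma measurableSet_crosses {Ω : Type*} (ξ : Ω → Set (Space d × Radius)) (x : Space d) (a : ℝ) :
    MeasurableSet[voidAlgebra ξ (Metric.ball x (10 * a) ×ˢ Set.univ)]
      {ω | Crosses (ξ ω) x a} := by
  have heq : {ω | Crosses (ξ ω) x a} = ⋃ n : ℕ, {ω | ∃ p ∈ {p : Fin (n + 1) → Space d × Radius |
      (∀ i : Fin n, dist (p i.castSucc).1 (p i.succ).1 < (p i.castSucc).2 + (p i.succ).2) ∧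
      dist (p 0).1 x < (p 0).2 + a ∧ 8 * a < dist (p (Fin.last n)).1 x + (p (Fin.last n)).2},
      ∀ i, p i ∈ ξ ω ∧ p i ∈ Metric.ball x (10 * a) ×ˢ (Set.univ : Set Radius)} := by
    ext ω
    simp only [Set.mem_ofPred_eq, Set.mem_iUnion]
    refine exists_congr fun n => ⟨?_, ?_⟩
    · rintro ⟨p, hp, hD, h0, hn⟩
      refine ⟨fun i => p i, ⟨fun i => ?_, by simpa using h0, by simpa using hn⟩, fun i =>
        ⟨hp.mem i (Nat.lt_succ_iff.1 i.2), hD i (Nat.lt_succ_iff.1 i.2), trivial⟩⟩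
      simpa using hp.adj i i.2
    · rintro ⟨p, ⟨hadj, h0, hn⟩, hp⟩
      refine ⟨fun i => p (Fin.ofNat (n + 1) i), ⟨fun i _ => (hp _).1, fun i hi => ?_⟩,
        fun i _ => (hp _).2.1, ?_, ?_⟩
      · have h1 : Fin.ofNat (n + 1) i = (⟨i, hi⟩ : Fin n).castSucc := by
          ext; simp [Nat.mod_eq_of_lt (hi.trans n.lt_succ_self)]
        have h2 : Fin.ofNat (n + 1) (i + 1) = (⟨i, hi⟩ : Fin n).succ := by
          ext; simp [Nat.mod_eq_of_lt (Nat.succ_lt_succ hi)]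
        simpa only [h1, h2] using hadj ⟨i, hi⟩
      · exact h0
      · have h1 : Fin.ofNat (n + 1) n = Fin.last n := by
          ext; simp
        simpa only [h1] using hn
  rw [heq]
  refine MeasurableSet.iUnion fun n => IsPoissonPointProcess.measurableSet_exists_tuple ξ
    (Metric.isOpen_ball.prod isOpen_univ) ?_
  simp only [Set.ofPred_and, Set.ofPred_forall]
  exact (isOpen_iInter_of_finite fun i => isOpen_lt (by fun_prop) (by fun_prop)).inter
    ((isOpen_lt (by fun_prop) (by fun_prop)).inter (isOpen_lt (by fun_prop) (by fun_prop)))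

/-- The pairs `(c, r)` with `r ≥ a` whose ball, magnified by `100`, contains `x`. -/
def largeBalls (x : Space d) (a : ℝ) : Set (Space d × Radius) :=
  {c | a ≤ c.2 ∧ dist c.1 x < 100 * c.2}

lemma measurableSet_largeBalls (x : Space d) (a : ℝ) : MeasurableSet (largeBalls x a) := by
  simp only [largeBalls, Set.ofPred_and]
  exact (measurableSet_le (by fun_prop) (by fun_prop)).inter
    (measurableSet_lt (by fun_prop) (by fun_prop))

/-- The tail `∫_{r ≥ a} r ^ d ν(dr)` of the `d`-th moment of the radius. -/
noncomputable def momentTail (d : ℕ) (ν : Measure Radius) (a : ℝ) : ℝ≥0∞ :=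
  ∫⁻ r in {r : Radius | a ≤ r}, ENNReal.ofReal ((r : ℝ) ^ d) ∂ν

lemma momentTail_le (ν : Measure Radius)
    (hν : Integrable (fun r : Radius => (r : ℝ) ^ d) ν) (a : ℝ) :
    momentTail d ν a ≤ ENNReal.ofReal (∫ r : Radius, (r : ℝ) ^ d ∂ν) := by
  rw [ofReal_integral_eq_lintegral_ofReal hν (ae_of_all _ fun r => pow_nonneg r.2.le d)]
  exact setLIntegral_le_lintegral _ _

lemma tendsto_momentTail (ν : Measure Radius)
    (hν : Integrable (fun r : Radius => (r : ℝ) ^ d) ν) :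
    Tendsto (momentTail d ν) atTop (𝓝 0) := by
  have hm : ∀ a : ℝ, MeasurableSet {r : Radius | a ≤ r} := fun a =>
    measurableSet_le (by fun_prop) (by fun_prop)
  have h0 : (0 : ℝ≥0∞) = ∫⁻ _ : Radius, 0 ∂ν := by simp
  unfold momentTail
  simp_rw [← lintegral_indicator (hm _)]
  rw [h0]
  refine tendsto_lintegral_filter_of_dominated_convergence
    (fun r => ENNReal.ofReal ((r : ℝ) ^ d)) ?_ ?_ ?_ ?_
  · exact Eventually.of_forall fun a => (Measurable.indicator (by fun_prop) (hm a))
  · exact Eventually.of_forall fun a => ae_of_all _ fun r => Set.indicator_le_self _ _ r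
  · rw [← ofReal_integral_eq_lintegral_ofReal hν (ae_of_all _ fun r => pow_nonneg r.2.le d)]
    exact ENNReal.ofReal_ne_top
  · refine ae_of_all _ fun r => tendsto_const_nhds.congr' ?_
    filter_upwards [eventually_gt_atTop (r : ℝ)] with a ha
    rw [Set.indicator_of_notMem]
    simpa using ha

/-- The intensity of a family of balls, by slicing along the radius. -/
lemma intensity_eq_lintegral (lam : ℝ) (ν : Measure Radius) [SFinite ν]
    {B : Set (Space d × Radius)} (hB : MeasurableSet B) :
    intensity d lam ν B =
      ENNReal.ofReal lam * ∫⁻ r, volume {c : Space d | (c, r) ∈ B} ∂ν := by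
  rw [intensity, Measure.prod_smul_left, Measure.smul_apply, Measure.prod_apply_symm hB, smul_eq_mul]
  rfl

lemma intensity_largeBalls_le (lam : ℝ) (ν : Measure Radius) [SFinite ν] (x : Space d) (a : ℝ) :
    intensity d lam ν (largeBalls x a) ≤ ENNReal.ofReal lam *
      (ENNReal.ofReal (100 ^ d) * volume (Metric.ball (0 : Space d) 1) * momentTail d ν a) := by
  have hm : MeasurableSet {r : Radius | a ≤ r} := measurableSet_le (by fun_prop) (by fun_prop)
  rw [intensity_eq_lintegral _ _ (measurableSet_largeBalls x a), momentTail,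
    ← lintegral_indicator hm, ← lintegral_const_mul _ (Measurable.indicator (by fun_prop) hm)]
  gcongr with r
  by_cases hr : a ≤ r
  · have hs : {c : Space d | (c, r) ∈ largeBalls x a} ⊆ Metric.ball x (100 * r) :=
      fun c hc => hc.2
    refine (measure_mono hs).trans ?_
    have h0 : (0 : ℝ) < 100 * r := mul_pos (by norm_num) r.2
    rw [Measure.addHaar_ball_of_pos _ _ h0, Set.indicator_of_mem (by exact hr), finrank_euclideanSpace_fin,
      mul_pow, ENNReal.ofReal_mul (by positivity)]
    apply le_of_eq
    ring
  · have hs : {c : Space d | (c, r) ∈ largeBalls x a} = ∅ := by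
      ext c; simp [largeBalls, hr]
    simp [hs]

lemma intensity_ball_prod_univ (lam : ℝ) (ν : Measure Radius) [IsProbabilityMeasure ν]
    (x : Space d) {a : ℝ} (ha : 0 < a) :
    intensity d lam ν (Metric.ball x a ×ˢ Set.univ) =
      ENNReal.ofReal lam * (ENNReal.ofReal (a ^ d) * volume (Metric.ball (0 : Space d) 1)) := by
  rw [intensity, Measure.prod_prod, measure_univ, mul_one, Measure.smul_apply, smul_eq_mul,
    Measure.addHaar_ball_of_pos _ _ ha, finrank_euclideanSpace_fin]

section

variable {Ω : Type*} [MeasurableSpace Ω] {P : Measure Ω} [IsProbabilityMeasure P]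
  {ξ : Ω → Set (Space d × Radius)} {lam : ℝ} {ν : Measure Radius}

/-- The largest probability, over all positions, of a crossing at scale `a`. -/
noncomputable def crossingProb (P : Measure Ω) (ξ : Ω → Set (Space d × Radius)) (a : ℝ) : ℝ≥0∞ :=
  ⨆ x, P {ω | Crosses (ξ ω) x a}

/-- A crossing uses a point with centre in `B(x, 10a)`, which is unlikely at small scales. -/
lemma crossingProb_le_of_pos [IsProbabilityMeasure ν]
    (h : IsPoissonPointProcess (intensity d lam ν) P ξ) {a : ℝ} (ha : 0 < a) :
    crossingProb P ξ a ≤ ENNReal.ofReal lam *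
      (ENNReal.ofReal ((10 * a) ^ d) * volume (Metric.ball (0 : Space d) 1)) := by
  refine iSup_le fun x => ?_
  rw [← intensity_ball_prod_univ lam ν x (by linarith)]
  refine le_trans (measure_mono ?_)
    (h.measure_hit_le (Metric.isOpen_ball.measurableSet.prod MeasurableSet.univ))
  rintro ω ⟨n, p, hp, hD, -⟩
  exact ⟨p 0, hp.mem 0 n.zero_le, hD 0 n.zero_le, trivial⟩

/-- The recursive estimate between the scales `a` and `10a`: a crossing at the larger scale uses
a large ball, or else contains two independent crossings at the smaller scale. -/
lemma crossingProb_ten_mul_le [IsProbabilityMeasure ν]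
    (h : IsPoissonPointProcess (intensity d lam ν) P ξ) {a : ℝ} (ha : 0 < a) {t : Finset (Space d)}
    (ht : Metric.closedBall (0 : Space d) 100 ⊆ ⋃ k ∈ t, Metric.ball k 1) :
    crossingProb P ξ (10 * a) ≤ ENNReal.ofReal lam *
      (ENNReal.ofReal (100 ^ d) * volume (Metric.ball (0 : Space d) 1) * momentTail d ν a) +
      (t.card : ℝ≥0∞) ^ 2 * crossingProb P ξ a ^ 2 := by
  classical
  refine iSup_le fun x => ?_
  set I : Finset (Space d × Space d) := (t ×ˢ t).filter fun kl => 20 ≤ dist kl.1 kl.2 with hI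
  have hsub : {ω | Crosses (ξ ω) x (10 * a)} ⊆ {ω | (ξ ω ∩ largeBalls x a).Nonempty} ∪
      ⋃ kl ∈ I, {ω | Crosses (ξ ω) (x + a • kl.1) a} ∩ {ω | Crosses (ξ ω) (x + a • kl.2) a} := by
    intro ω hω
    by_cases hl : (ξ ω ∩ largeBalls x a).Nonempty
    · exact Or.inl hl
    · right
      obtain ⟨k, hk, l, hl, hkl, hck, hcl⟩ := Crosses.exists_pair ht ha hω fun c hc hcx => by
        by_contra! hac
        exact hl ⟨c, hc, hac, by linarith⟩
      exact Set.mem_iUnion₂.2 ⟨(k, l), by simp only [hI, Finset.mem_filter, Finset.mem_product]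
                                          exact ⟨⟨hk, hl⟩, hkl⟩, hck, hcl⟩
  have hpair : ∀ kl ∈ I, P ({ω | Crosses (ξ ω) (x + a • kl.1) a} ∩
      {ω | Crosses (ξ ω) (x + a • kl.2) a}) ≤ crossingProb P ξ a ^ 2 := by
    intro kl hkl
    have hd : 20 ≤ dist kl.1 kl.2 := (Finset.mem_filter.1 hkl).2
    have hdisj : Disjoint (Metric.ball (x + a • kl.1) (10 * a) ×ˢ (Set.univ : Set Radius))
        (Metric.ball (x + a • kl.2) (10 * a) ×ˢ Set.univ) := by
      rw [Set.disjoint_prod]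
      refine Or.inl (Metric.ball_disjoint_ball ?_)
      rw [dist_add_left, dist_smul₀, Real.norm_of_nonneg ha.le]
      nlinarith
    rw [(Indep_iff _ _ P).1 (h.indep_voidAlgebra hdisj) _ _ (measurableSet_crosses ξ _ a)
      (measurableSet_crosses ξ _ a), sq]
    exact mul_le_mul' (le_iSup (fun x => P {ω | Crosses (ξ ω) x a}) _)
      (le_iSup (fun x => P {ω | Crosses (ξ ω) x a}) _)
  calc P {ω | Crosses (ξ ω) x (10 * a)}
      ≤ P {ω | (ξ ω ∩ largeBalls x a).Nonempty} + P (⋃ kl ∈ I,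
          {ω | Crosses (ξ ω) (x + a • kl.1) a} ∩ {ω | Crosses (ξ ω) (x + a • kl.2) a}) :=
        (measure_mono hsub).trans (measure_union_le _ _)
    _ ≤ _ := by
        refine add_le_add ((h.measure_hit_le (measurableSet_largeBalls x a)).trans
          (intensity_largeBalls_le lam ν x a)) ?_
        refine (measure_biUnion_finset_le _ _).trans ((Finset.sum_le_card_nsmul _ _ _ hpair).trans ?_)
        rw [nsmul_eq_mul]
        gcongr
        have hc : I.card ≤ t.card ^ 2 := by
          rw [sq, ← Finset.card_product]; exact Finset.card_filter_le _ _
        exact_mod_cast hc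

lemma measure_percolates_le [IsProbabilityMeasure ν]
    (h : IsPoissonPointProcess (intensity d lam ν) P ξ) {a : ℝ} (ha : 0 < a) :
    P {ω | Percolates (ξ ω)} ≤ crossingProb P ξ a + ENNReal.ofReal lam *
      (ENNReal.ofReal (100 ^ d) * volume (Metric.ball (0 : Space d) 1) * momentTail d ν a) := by
  have hsub : {ω | Percolates (ξ ω)} ⊆
      {ω | Crosses (ξ ω) 0 a} ∪ {ω | (ξ ω ∩ largeBalls 0 a).Nonempty} := by
    intro ω hω
    rcases hω.crosses_or ha with hc | ⟨c, hc, h1, h2⟩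
    · exact Or.inl hc
    · exact Or.inr ⟨c, hc, by linarith, by linarith⟩
  refine (measure_mono hsub).trans ((measure_union_le _ _).trans (add_le_add ?_ ?_))
  · exact le_iSup (fun x => P {ω | Crosses (ξ ω) x a}) 0
  · exact (h.measure_hit_le (measurableSet_largeBalls 0 a)).trans
      (intensity_largeBalls_le lam ν 0 a)

end

/-- A sequence with `u (n + 1) ≤ e n + u n ^ 2` that starts below `1 / 2` tends to zero, if `e`
is at most `1 / 4` and tends to zero. -/
lemma tendsto_zero_of_le_add_sq {u e : ℕ → ℝ≥0∞} (h0 : u 0 ≤ 2⁻¹) (he : ∀ n, e n ≤ 4⁻¹)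
    (hrec : ∀ n, u (n + 1) ≤ e n + u n ^ 2) (hlim : Tendsto e atTop (𝓝 0)) :
    Tendsto u atTop (𝓝 0) := by
  have h4 : (2⁻¹ : ℝ≥0∞) * 2⁻¹ = 4⁻¹ := by
    rw [← ENNReal.mul_inv (by simp) (by simp)]; norm_num
  have hhalf : (4⁻¹ : ℝ≥0∞) + 4⁻¹ = 2⁻¹ := by
    rw [← h4, ← mul_add, ENNReal.inv_two_add_inv_two, mul_one]
  have hu : ∀ n, u n ≤ 2⁻¹ := by
    intro n
    induction n with
    | zero => exact h0
    | succ n ih =>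
      refine (hrec n).trans ((add_le_add (he n) ?_).trans hhalf.le)
      rw [sq, ← h4]; exact mul_le_mul' ih ih
  have hL : limsup u atTop ≤ 2⁻¹ * limsup u atTop := by
    refine ENNReal.le_of_forall_pos_le_add fun ε hε _ => ?_
    calc limsup u atTop = limsup (fun n => u (n + 1)) atTop := (limsup_nat_add u 1).symm
      _ ≤ limsup (fun n => 2⁻¹ * u n + (ε : ℝ≥0∞)) atTop := by
          refine limsup_le_limsup ?_
          filter_upwards [hlim.eventually_le_const (ENNReal.coe_pos.2 hε)] with n hn
          refine (hrec n).trans ?_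
          rw [add_comm, sq]
          gcongr
          exact hu n
      _ = 2⁻¹ * limsup u atTop + ε := by
          rw [limsup_add_const _ _ _ (by isBoundedDefault) (by isBoundedDefault),
            ENNReal.limsup_const_mul_of_ne_top (by simp)]
  have hfin : limsup u atTop ≠ ⊤ := by
    refine ne_top_of_le_ne_top (b := 2⁻¹) (by simp) ?_
    exact limsup_le_of_le (by isBoundedDefault) (Eventually.of_forall hu)
  have hzero : limsup u atTop = 0 := by
    by_contra hne
    have := ENNReal.mul_lt_mul_left hne hfin (show (2⁻¹ : ℝ≥0∞) < 1 by simp)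
    rw [one_mul] at this
    exact absurd hL (not_le.2 this)
  exact tendsto_of_le_liminf_of_limsup_le bot_le hzero.le

theorem exists_percolationNull_of_integrable {d : ℕ} (hd : 1 ≤ d) :
    ∃ C : ℝ, 0 < C ∧ ∀ (ν : Measure Radius) [IsProbabilityMeasure ν],
      Integrable (fun r : Radius => (r : ℝ) ^ d) ν →
        ∀ lam : ℝ, 0 < lam → lam < C * (∫ r : Radius, (r : ℝ) ^ d ∂ν)⁻¹ →
          PercolationNull.{u} d lam ν := by
  obtain ⟨t, -, ht⟩ := (isCompact_closedBall (0 : Space d) 100).elim_nhds_subcover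
    (fun k => Metric.ball k 1) fun k _ => Metric.ball_mem_nhds k one_pos
  obtain ⟨v, hv0, hvol⟩ : ∃ v : ℝ, 0 < v ∧
      volume (Metric.ball (0 : Space d) 1) = ENNReal.ofReal v :=
    ⟨_, ENNReal.toReal_pos (Metric.measure_ball_pos _ _ one_pos).ne' measure_ball_lt_top.ne,
      (ENNReal.ofReal_toReal measure_ball_lt_top.ne).symm⟩
  obtain ⟨A, hA0, htA, h1A⟩ : ∃ A : ℝ, 0 < A ∧ (t.card : ℝ≥0∞) ^ 2 ≤ ENNReal.ofReal A ∧
      1 ≤ ENNReal.ofReal A := by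
    refine ⟨(t.card : ℝ) ^ 2 + 1, by positivity, ?_, ?_⟩
    · rw [← ENNReal.ofReal_natCast, ← ENNReal.ofReal_pow (by positivity)]
      exact ENNReal.ofReal_le_ofReal (by linarith)
    · rw [← ENNReal.ofReal_one]
      exact ENNReal.ofReal_le_ofReal (by nlinarith [sq_nonneg (t.card : ℝ)])
  have hB0 : (0 : ℝ) < 4 * (A * (100 ^ d * v)) := by positivity
  refine ⟨(4 * (A * (100 ^ d * v)))⁻¹, inv_pos.2 hB0, fun ν _ hν lam hlam hlt Ω _ P _ ξ hξ => ?_⟩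
  obtain ⟨M, hM⟩ : ∃ M : ℝ, M = ∫ r : Radius, (r : ℝ) ^ d ∂ν := ⟨_, rfl⟩
  have hM0 : 0 ≤ M := hM ▸ integral_nonneg fun r => pow_nonneg r.2.le d
  have hbound : A * (lam * (100 ^ d * v * M)) ≤ 1 / 4 := by
    rw [← hM] at hlt
    rcases hM0.eq_or_lt with h | h
    · rw [← h]; norm_num
    · rw [← mul_inv, lt_inv_comm₀ hlam (by positivity), ← one_div, lt_div_iff₀ hlam] at hlt
      linarith
  -- at the initial scale `s / 10` the crossing probability is small, whatever `lam` is
  obtain ⟨s, hs0, hs⟩ : ∃ s : ℝ, 0 < s ∧ A * (lam * (s ^ d * v)) ≤ 1 / 2 := by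
    have hK : 0 < 2 * (A * (lam * v)) := by positivity
    refine ⟨min 1 (2 * (A * (lam * v)))⁻¹, lt_min one_pos (inv_pos.2 hK), ?_⟩
    have h1 : (min 1 (2 * (A * (lam * v)))⁻¹) ^ d ≤ (2 * (A * (lam * v)))⁻¹ :=
      (pow_le_of_le_one (le_min zero_le_one (inv_pos.2 hK).le) (min_le_left _ _)
        (by omega)).trans (min_le_right _ _)
    have h2 := mul_le_mul_of_nonneg_right h1 hK.le
    rw [inv_mul_cancel₀ hK.ne'] at h2
    linarith
  set a : ℕ → ℝ := fun n => s / 10 * 10 ^ n with ha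
  have ha0 : ∀ n, 0 < a n := fun n => by simp only [ha]; positivity
  have hasucc : ∀ n, a (n + 1) = 10 * a n := fun n => by simp only [ha, pow_succ]; ring
  have hatop : Tendsto a atTop atTop :=
    (tendsto_pow_atTop_atTop_of_one_lt (by norm_num)).const_mul_atTop (by positivity)
  set e : ℕ → ℝ≥0∞ := fun n => ENNReal.ofReal A * (ENNReal.ofReal lam *
      (ENNReal.ofReal (100 ^ d) * volume (Metric.ball (0 : Space d) 1) * momentTail d ν (a n)))
    with he
  have helim : Tendsto e atTop (𝓝 0) := by
    have h1 := (tendsto_momentTail ν hν).comp hatop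
    have h2 := ENNReal.Tendsto.const_mul (a := ENNReal.ofReal A * (ENNReal.ofReal lam *
      (ENNReal.ofReal (100 ^ d) * volume (Metric.ball (0 : Space d) 1)))) h1
      (Or.inr (by rw [hvol]; finiteness))
    rw [mul_zero] at h2
    refine h2.congr fun n => ?_
    simp only [he, Function.comp_apply]
    ring
  have he4 : ∀ n, e n ≤ 4⁻¹ := by
    intro n
    calc e n ≤ ENNReal.ofReal A * (ENNReal.ofReal lam *
          (ENNReal.ofReal (100 ^ d) * ENNReal.ofReal v * ENNReal.ofReal M)) := by
          simp only [he, hvol]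
          gcongr
          exact hM ▸ momentTail_le ν hν (a n)
      _ = ENNReal.ofReal (A * (lam * (100 ^ d * v * M))) := by
          rw [ENNReal.ofReal_mul hA0.le, ENNReal.ofReal_mul hlam.le,
            ENNReal.ofReal_mul (by positivity), ENNReal.ofReal_mul (by positivity)]
      _ ≤ ENNReal.ofReal (1 / 4) := ENNReal.ofReal_le_ofReal hbound
      _ = 4⁻¹ := by rw [one_div, ENNReal.ofReal_inv_of_pos (by norm_num)]; norm_num
  have hu0 : ENNReal.ofReal A * crossingProb P ξ (a 0) ≤ 2⁻¹ := by
    have h10 : 10 * a 0 = s := by simp only [ha, pow_zero]; ring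
    calc ENNReal.ofReal A * crossingProb P ξ (a 0)
        ≤ ENNReal.ofReal A * (ENNReal.ofReal lam * (ENNReal.ofReal (s ^ d) * ENNReal.ofReal v)) := by
          gcongr
          rw [← hvol, ← h10]
          exact crossingProb_le_of_pos hξ (ha0 0)
      _ = ENNReal.ofReal (A * (lam * (s ^ d * v))) := by
          rw [ENNReal.ofReal_mul hA0.le, ENNReal.ofReal_mul hlam.le,
            ENNReal.ofReal_mul (by positivity)]
      _ ≤ ENNReal.ofReal (1 / 2) := ENNReal.ofReal_le_ofReal hs
      _ = 2⁻¹ := by rw [one_div, ENNReal.ofReal_inv_of_pos (by norm_num)]; norm_num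
  -- multiplication by `A` absorbs the number of pairs of net points in the recursive estimate
  have hulim : Tendsto (fun n => ENNReal.ofReal A * crossingProb P ξ (a n)) atTop (𝓝 0) := by
    refine tendsto_zero_of_le_add_sq hu0 he4 (fun n => ?_) helim
    rw [hasucc]
    calc ENNReal.ofReal A * crossingProb P ξ (10 * a n)
        ≤ ENNReal.ofReal A * (ENNReal.ofReal lam * (ENNReal.ofReal (100 ^ d) *
            volume (Metric.ball (0 : Space d) 1) * momentTail d ν (a n)) +
            ENNReal.ofReal A * crossingProb P ξ (a n) ^ 2) := by
          gcongr
          refine (crossingProb_ten_mul_le hξ (ha0 n) ht).trans ?_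
          gcongr
      _ = e n + (ENNReal.ofReal A * crossingProb P ξ (a n)) ^ 2 := by
          simp only [he]; ring
  have hle : ∀ n, P {ω | Percolates (ξ ω)} ≤ ENNReal.ofReal A * crossingProb P ξ (a n) + e n :=
    fun n => (measure_percolates_le hξ (ha0 n)).trans
      (add_le_add (le_mul_of_one_le_left' h1A) (le_mul_of_one_le_left' h1A))
  have hlim := hulim.add helim
  rw [add_zero] at hlim
  exact le_antisymm (ge_of_tendsto' hlim hle) bot_le

end BooleanModel

/-! ### A Poisson number of independent points -/

/-- Independent pairs `Z k` consisting of a Poisson number `(Z k).1` with mean `c k` and of an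
independent sequence `(Z k).2` of independent points with law `q k`. The first `(Z k).1` terms of
the sequence are the points of a Poisson process with intensity `c k • q k`. -/
structure IsPoissonSample {X : Type*} [MeasurableSpace X] {Ω : Type*} [MeasurableSpace Ω]
    (c : ℕ → ℝ≥0) (q : ℕ → Measure X) (P : Measure Ω) (Z : ℕ → Ω → ℕ × (ℕ → X)) : Prop where
  measurable : ∀ k, Measurable (Z k)
  indep : iIndepFun Z P
  law : ∀ k, P.map (Z k) = (poissonMeasure (c k)).prod (Measure.infinitePi fun _ => q k)

section

variable {X : Type*} [MeasurableSpace X]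

lemma integral_indicator_one_complex {μ : Measure X} {s : Set X} (hs : MeasurableSet s) :
    ∫ x, s.indicator (1 : X → ℂ) x ∂μ = (μ.real s : ℂ) := by
  rw [integral_indicator hs]
  simp

lemma measurable_prod_range {h : X → ℂ} (hm : Measurable h) :
    Measurable fun z : ℕ × (ℕ → X) => ∏ i ∈ Finset.range z.1, h (z.2 i) :=
  measurable_from_prod_countable_right fun n => by
    simp only; fun_prop

/-- Multiplicative functionals of a Poisson number of independent points. -/
lemma integral_prod_poisson (c : ℝ≥0) (q : Measure X) [IsProbabilityMeasure q] {h : X → ℂ}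
    (hm : Measurable h) (hb : ∀ x, ‖h x‖ ≤ 1) :
    ∫ z, ∏ i ∈ Finset.range z.1, h (z.2 i)
      ∂((poissonMeasure c).prod (Measure.infinitePi fun _ : ℕ => q)) =
      Complex.exp (c * (∫ x, h x ∂q - 1)) := by
  have hmeas := measurable_prod_range hm
  have hpow : ∀ n : ℕ, ∫ y, ∏ i ∈ Finset.range n, h (y i) ∂(Measure.infinitePi fun _ : ℕ => q) =
      (∫ x, h x ∂q) ^ n := by
    intro n
    have hi := (iIndepFun_infinitePi (P := fun _ : ℕ => q) (X := fun _ => h) fun _ => hm).precomp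
      (Fin.val_injective (n := n))
    have h1 := hi.integral_fun_prod_eq_prod_integral fun i =>
      (hm.comp (measurable_pi_apply (i : ℕ))).aestronglyMeasurable
    have h2 : ∀ i : ℕ, ∫ y, h (y i) ∂(Measure.infinitePi fun _ : ℕ => q) = ∫ x, h x ∂q := by
      intro i
      rw [← integral_map (φ := fun y : ℕ → X => y i) (measurable_pi_apply i).aemeasurable
        (hm.aestronglyMeasurable), Measure.infinitePi_map_eval]
    simp only [h2, Finset.prod_const, Finset.card_univ, Fintype.card_fin] at h1
    rw [← h1]
    simp only [Finset.prod_range]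
  rw [integral_prod _ (Integrable.of_bound hmeas.aestronglyMeasurable 1
    (ae_of_all _ fun z => by
      rw [norm_prod]; exact Finset.prod_le_one (fun _ _ => norm_nonneg _) fun _ _ => hb _))]
  simp only [hpow]
  rw [integral_poissonMeasure]
  set w := ∫ x, h x ∂q
  calc ∑' n : ℕ, (Real.exp (-c) * c ^ n / n.factorial : ℝ) • w ^ n
      = ∑' n : ℕ, (Real.exp (-c) : ℂ) * ((c * w) ^ n / n.factorial) := by
        congr with n
        rw [Complex.real_smul]
        push_cast
        rw [mul_pow]
        ring
    _ = (Real.exp (-c) : ℂ) * Complex.exp (c * w) := by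
        rw [tsum_mul_left, (NormedSpace.expSeries_div_hasSum_exp (c * w : ℂ)).tsum_eq,
          Complex.exp_eq_exp_ℂ]
    _ = Complex.exp (c * (w - 1)) := by
        rw [Complex.ofReal_exp, ← Complex.exp_add]
        push_cast
        ring_nf

end

namespace IsPoissonSample

variable {X : Type*} [MeasurableSpace X] {Ω : Type*} [MeasurableSpace Ω] {c : ℕ → ℝ≥0}
  {q : ℕ → Measure X} {P : Measure Ω}
  {Z : ℕ → Ω → ℕ × (ℕ → X)}

lemma measurable_prod (hZ : IsPoissonSample c q P Z) {h : X → ℂ} (hm : Measurable h) (k : ℕ) :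
    Measurable fun ω => ∏ i ∈ Finset.range (Z k ω).1, h ((Z k ω).2 i) := by
  exact (measurable_prod_range hm).comp (hZ.measurable k)

/-- The indices of the points of the sample that lie in `B`. -/
def indices (Z : ℕ → Ω → ℕ × (ℕ → X)) (B : Set X) (ω : Ω) : Set (ℕ × ℕ) :=
  {a | a.2 < (Z a.1 ω).1 ∧ (Z a.1 ω).2 a.2 ∈ B}

lemma measurableSet_mem_indices (hZ : IsPoissonSample c q P Z) {B : Set X} (hB : MeasurableSet B)
    (a : ℕ × ℕ) : MeasurableSet {ω | a ∈ indices Z B ω} := by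
  have h1 : Measurable fun ω => (Z a.1 ω).1 := (hZ.measurable a.1).fst
  have h2 : Measurable fun ω => (Z a.1 ω).2 a.2 :=
    (measurable_pi_apply a.2).comp (hZ.measurable a.1).snd
  simp only [indices, Set.ofPred_and]
  exact (measurableSet_lt measurable_const h1).inter (h2 hB)

lemma measurable_encard_indices (hZ : IsPoissonSample c q P Z) {B : Set X}
    (hB : MeasurableSet B) : Measurable fun ω => (indices Z B ω).encard := by
  have hle : ∀ n : ℕ, MeasurableSet {ω | (n : ℕ∞) ≤ (indices Z B ω).encard} := by
    intro n
    have heq : {ω | (n : ℕ∞) ≤ (indices Z B ω).encard} =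
        ⋃ F : {F : Finset (ℕ × ℕ) // F.card = n}, ⋂ a ∈ F.1, {ω | a ∈ indices Z B ω} := by
      ext ω
      simp only [Set.mem_ofPred_eq, Set.mem_iUnion, Set.mem_iInter]
      constructor
      · intro h
        obtain ⟨t, hts, htn⟩ := Set.exists_subset_encard_eq h
        have hfin : t.Finite := Set.finite_of_encard_eq_coe htn
        refine ⟨⟨hfin.toFinset, ?_⟩, fun a ha => hts (hfin.mem_toFinset.1 ha)⟩
        rw [hfin.encard_eq_coe_toFinset_card] at htn
        exact_mod_cast htn
      · rintro ⟨⟨F, rfl⟩, hF⟩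
        rw [← Set.encard_coe_eq_coe_finsetCard]
        exact Set.encard_le_encard fun a ha => hF a ha
    rw [heq]
    exact MeasurableSet.iUnion fun F => Finset.measurableSet_biInter _ fun a _ =>
      hZ.measurableSet_mem_indices hB a
  refine ENat.measurable_iff.2 fun n => ?_
  have heq : (fun ω => (indices Z B ω).encard) ⁻¹' {(n : ℕ∞)} =
      {ω | (n : ℕ∞) ≤ (indices Z B ω).encard} \
        {ω | ((n + 1 : ℕ) : ℕ∞) ≤ (indices Z B ω).encard} := by
    ext ω
    simp only [Set.mem_preimage, Set.mem_singleton_iff, Set.mem_sdiff, Set.mem_ofPred_eq, not_le]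
    generalize (indices Z B ω).encard = m
    cases m with
    | top => simp
    | coe m => norm_cast; omega
  rw [heq]
  exact (hle n).diff (hle (n + 1))

variable [∀ k, IsProbabilityMeasure (q k)]

lemma integral_prod (hZ : IsPoissonSample c q P Z) {h : X → ℂ} (hm : Measurable h)
    (hb : ∀ x, ‖h x‖ ≤ 1) (k : ℕ) :
    ∫ ω, ∏ i ∈ Finset.range (Z k ω).1, h ((Z k ω).2 i) ∂P =
      Complex.exp (c k * (∫ x, h x ∂(q k) - 1)) := by
  have hmeas := measurable_prod_range hm
  rw [← integral_prod_poisson (c k) (q k) hm hb, ← hZ.law k,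
    integral_map (hZ.measurable k).aemeasurable hmeas.aestronglyMeasurable]

lemma integral_prod_prod (hZ : IsPoissonSample c q P Z) {h : X → ℂ} (hm : Measurable h)
    (hb : ∀ x, ‖h x‖ ≤ 1) (K : ℕ) :
    ∫ ω, ∏ k ∈ Finset.range K, ∏ i ∈ Finset.range (Z k ω).1, h ((Z k ω).2 i) ∂P =
      Complex.exp (∑ k ∈ Finset.range K, c k * (∫ x, h x ∂(q k) - 1)) := by
  have hmeas := measurable_prod_range hm
  have hi := (hZ.indep.comp (fun _ z => ∏ i ∈ Finset.range z.1, h (z.2 i)) fun _ => hmeas).precomp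
    (Fin.val_injective (n := K))
  have h1 := hi.integral_fun_prod_eq_prod_integral fun i =>
    (hmeas.comp (hZ.measurable i)).aestronglyMeasurable
  simp only [Function.comp_apply] at h1
  rw [Complex.exp_sum]
  simp only [Finset.prod_range (n := K)]
  rw [h1]
  exact Finset.prod_congr rfl fun k _ => hZ.integral_prod hm hb k

variable [IsProbabilityMeasure P]

lemma measure_exists_mem_le (hZ : IsPoissonSample c q P Z) {B : Set X} (hB : MeasurableSet B)
    (k : ℕ) : P {ω | ∃ i, (k, i) ∈ indices Z B ω} ≤ c k • q k B := by
  classical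
  -- for this `h` the multiplicative functional is the indicator of having no point in `B`
  set h : X → ℂ := Set.indicator Bᶜ 1 with hh
  have hm : Measurable h := measurable_one.indicator hB.compl
  have hb : ∀ x, ‖h x‖ ≤ 1 := fun x => by
    simp only [hh, Set.indicator_apply]; split_ifs <;> simp
  have hS : MeasurableSet {ω | ∃ i, (k, i) ∈ indices Z B ω} := by
    rw [Set.ofPred_exists]
    exact MeasurableSet.iUnion fun i => hZ.measurableSet_mem_indices hB (k, i)
  have h1 : ∀ ω, ∏ i ∈ Finset.range (Z k ω).1, h ((Z k ω).2 i) =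
      Set.indicator {ω | ∃ i, (k, i) ∈ indices Z B ω}ᶜ 1 ω := by
    intro ω
    by_cases hω : ∃ i, (k, i) ∈ indices Z B ω
    · rw [Set.indicator_of_notMem (by simpa using hω)]
      obtain ⟨i, hi1, hi2⟩ := hω
      refine Finset.prod_eq_zero (Finset.mem_range.2 hi1) ?_
      simp only [hh]
      exact Set.indicator_of_notMem (by simpa using hi2) _
    · rw [Set.indicator_of_mem (by simpa using hω)]
      refine Finset.prod_eq_one fun i hi => ?_
      push Not at hω
      simp only [hh]
      exact Set.indicator_of_mem (s := Bᶜ)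
        (fun hiB => hω i ⟨Finset.mem_range.1 hi, hiB⟩) (1 : X → ℂ)
  have h2 := hZ.integral_prod hm hb k
  rw [integral_congr_ae (ae_of_all _ h1), integral_indicator_one_complex hS.compl,
    integral_indicator_one_complex hB.compl, probReal_compl_eq_one_sub hB,
    probReal_compl_eq_one_sub hS] at h2
  have h3 : 1 - P.real {ω | ∃ i, (k, i) ∈ indices Z B ω} = Real.exp (-(c k * (q k).real B)) := by
    have h4 : (c k : ℂ) * (((1 - (q k).real B : ℝ) : ℂ) - 1) =
        ((-(c k * (q k).real B) : ℝ) : ℂ) := by push_cast; ring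
    rw [h4, ← Complex.ofReal_exp] at h2
    exact_mod_cast h2
  have h5 : P.real {ω | ∃ i, (k, i) ∈ indices Z B ω} ≤ c k * (q k).real B := by
    linarith [Real.add_one_le_exp (-(c k * (q k).real B))]
  rw [← ENNReal.ofReal_le_ofReal_iff (by positivity), ofReal_measureReal,
    ENNReal.ofReal_mul (by positivity), ofReal_measureReal, ENNReal.ofReal_coe_nnreal] at h5
  exact h5

/-- Almost surely, only finitely many of the families put a point in a set of finite intensity. -/
lemma ae_exists_bound (hZ : IsPoissonSample c q P Z) {B : Set X} (hB : MeasurableSet B)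
    (hfin : Measure.sum (fun k => c k • q k) B ≠ ⊤) :
    ∀ᵐ ω ∂P, ∃ K, ∀ a ∈ indices Z B ω, a.1 < K := by
  rw [Measure.sum_apply _ hB] at hfin
  have h1 : ∑' k, P {ω | ∃ i, (k, i) ∈ indices Z B ω} ≠ ⊤ :=
    ne_top_of_le_ne_top hfin (ENNReal.tsum_le_tsum fun k => hZ.measure_exists_mem_le hB k)
  filter_upwards [ae_eventually_notMem h1] with ω hω
  obtain ⟨K, hK⟩ := eventually_atTop.1 hω
  refine ⟨K, fun a ha => ?_⟩
  by_contra! hlt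
  exact hK a.1 hlt ⟨a.2, ha⟩

end IsPoissonSample

/-! ### The counts of a Poisson sample -/

namespace IsPoissonSample

variable {X : Type*} {Ω : Type*} {Z : ℕ → Ω → ℕ × (ℕ → X)}

lemma coe_indices_eq {B : Set X} {ω : Ω} {K : ℕ} (hK : ∀ a ∈ indices Z B ω, a.1 < K)
    [DecidablePred (· ∈ B)] :
    indices Z B ω = (((Finset.range K).sigma fun k =>
      (Finset.range (Z k ω).1).filter fun i => (Z k ω).2 i ∈ B).map
        (Equiv.sigmaEquivProd ℕ ℕ).toEmbedding : Finset (ℕ × ℕ)) := by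
  ext ⟨k, i⟩
  simp only [indices, Set.mem_ofPred_eq, Finset.coe_map, Set.mem_image, Finset.mem_coe,
    Finset.mem_sigma, Finset.mem_range, Finset.mem_filter]
  constructor
  · intro h
    exact ⟨⟨k, i⟩, ⟨hK (k, i) h, h.1, h.2⟩, rfl⟩
  · rintro ⟨⟨k', i'⟩, ⟨-, h1, h2⟩, h⟩
    obtain ⟨rfl, rfl⟩ := Prod.mk.inj h
    exact ⟨h1, h2⟩

lemma ncard_indices {B : Set X} {ω : Ω} {K : ℕ} (hK : ∀ a ∈ indices Z B ω, a.1 < K) (s : ℝ) :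
    s * (indices Z B ω).ncard = ∑ k ∈ Finset.range K, ∑ i ∈ Finset.range (Z k ω).1,
      B.indicator (fun _ => s) ((Z k ω).2 i) := by
  classical
  rw [coe_indices_eq hK, Set.ncard_coe_finset, Finset.card_map, Finset.card_sigma]
  push_cast
  rw [Finset.mul_sum]
  refine Finset.sum_congr rfl fun k _ => ?_
  simp [Set.indicator_apply, Finset.sum_ite, mul_comm]

lemma finite_indices {B : Set X} {ω : Ω} {K : ℕ} (hK : ∀ a ∈ indices Z B ω, a.1 < K) :
    (indices Z B ω).Finite := by
  classical
  rw [coe_indices_eq hK]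
  exact Finset.finite_toSet _

variable [MeasurableSpace X] [MeasurableSpace Ω] {c : ℕ → ℝ≥0} {q : ℕ → Measure X} {P : Measure Ω}

lemma measurable_ncard_indices (hZ : IsPoissonSample c q P Z) {B : Set X} (hB : MeasurableSet B) :
    Measurable fun ω => ((indices Z B ω).ncard : ℝ) :=
  (Measurable.of_discrete (f := fun m : ℕ∞ => (m.toNat : ℝ))).comp
    (hZ.measurable_encard_indices hB)

variable [∀ k, IsProbabilityMeasure (q k)] [IsProbabilityMeasure P] {ι : Type*} [Fintype ι]
  {B : ι → Set X}

/-- The joint characteristic function of the numbers of points in disjoint sets. -/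
lemma integral_exp_ncard (hZ : IsPoissonSample c q P Z) (hB : ∀ j, MeasurableSet (B j))
    (hdisj : Pairwise fun i j => Disjoint (B i) (B j))
    (hfin : ∀ j, Measure.sum (fun k => c k • q k) (B j) ≠ ⊤) (t : ι → ℝ) :
    ∫ ω, Complex.exp (((∑ j, t j * (indices Z (B j) ω).ncard : ℝ) : ℂ) * Complex.I) ∂P =
      ∏ j, Complex.exp ((Measure.sum (fun k => c k • q k)).real (B j) *
        (Complex.exp (t j * Complex.I) - 1)) := by
  classical
  set μ := Measure.sum (fun k => c k • q k) with hμ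
  set h : X → ℂ := fun x =>
    Complex.exp (((∑ j, (B j).indicator (fun _ => t j) x : ℝ) : ℂ) * Complex.I) with hh
  have hm : Measurable h := by
    have : Measurable fun x => ∑ j, (B j).indicator (fun _ => t j) x :=
      Finset.measurable_sum _ fun j _ => measurable_const.indicator (hB j)
    fun_prop
  have hb : ∀ x, ‖h x‖ ≤ 1 := fun x => (Complex.norm_exp_ofReal_mul_I _).le
  -- only one indicator is non-zero at a given point
  have hsub : ∀ x, h x - 1 =
      ∑ j, (Complex.exp (t j * Complex.I) - 1) * (B j).indicator (1 : X → ℂ) x := by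
    intro x
    by_cases hx : ∃ j, x ∈ B j
    · obtain ⟨j, hj⟩ := hx
      have hne : ∀ i, i ≠ j → x ∉ B i := fun i hij hi =>
        Set.disjoint_left.1 (hdisj hij) hi hj
      simp only [hh]
      rw [Finset.sum_eq_single j (fun i _ hij => Set.indicator_of_notMem (hne i hij) _) (by simp),
        Finset.sum_eq_single j (fun i _ hij => by
          rw [Set.indicator_of_notMem (hne i hij), mul_zero]) (by simp)]
      simp [hj]
    · push Not at hx
      simp [hh, hx]
  have hint1 : ∀ j, Integrable ((B j).indicator (1 : X → ℂ)) μ := fun j =>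
    (integrable_indicator_iff (hB j)).2 (integrableOn_const (hfin j))
  have hint : Integrable (fun x => h x - 1) μ := by
    simp only [hsub]
    exact integrable_finsetSum _ fun j _ => (hint1 j).const_mul _
  have hval : ∫ x, (h x - 1) ∂μ =
      ∑ j, μ.real (B j) * (Complex.exp (t j * Complex.I) - 1) := by
    simp only [hsub]
    rw [integral_finsetSum _ fun j _ => (hint1 j).const_mul _]
    refine Finset.sum_congr rfl fun j _ => ?_
    rw [integral_const_mul, integral_indicator_one_complex (hB j), mul_comm]
  -- the first `K` families contribute an explicit value, which converges to the product
  have hlim1 : Tendsto (fun K => ∫ ω, ∏ k ∈ Finset.range K, ∏ i ∈ Finset.range (Z k ω).1,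
      h ((Z k ω).2 i) ∂P) atTop
      (𝓝 (∏ j, Complex.exp (μ.real (B j) * (Complex.exp (t j * Complex.I) - 1)))) := by
    rw [← Complex.exp_sum, ← hval]
    simp only [hZ.integral_prod_prod hm hb]
    refine (Complex.continuous_exp.tendsto _).comp ?_
    have h1 := (hasSum_integral_measure hint).tendsto_sum_nat
    refine h1.congr fun K => Finset.sum_congr rfl fun k _ => ?_
    have hq : Integrable h (q k) := Integrable.of_bound hm.aestronglyMeasurable 1 (ae_of_all _ hb)
    rw [integral_smul_nnreal_measure, integral_sub hq (integrable_const 1)]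
    simp [NNReal.smul_def]
  -- almost surely, the families of large index do not contribute at all
  have hlim2 : Tendsto (fun K => ∫ ω, ∏ k ∈ Finset.range K, ∏ i ∈ Finset.range (Z k ω).1,
      h ((Z k ω).2 i) ∂P) atTop
      (𝓝 (∫ ω, Complex.exp (((∑ j, t j * (indices Z (B j) ω).ncard : ℝ) : ℂ) * Complex.I) ∂P)) := by
    refine tendsto_integral_of_dominated_convergence (fun _ => 1) (fun K => ?_)
      (integrable_const 1) (fun K => ae_of_all _ fun ω => ?_) ?_
    · exact (Finset.measurable_prod _ fun k _ => hZ.measurable_prod hm k).aestronglyMeasurable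
    · rw [norm_prod]
      refine Finset.prod_le_one (fun _ _ => norm_nonneg _) fun k _ => ?_
      rw [norm_prod]
      exact Finset.prod_le_one (fun _ _ => norm_nonneg _) fun _ _ => hb _
    · filter_upwards [ae_all_iff.2 fun j => hZ.ae_exists_bound (hB j) (hfin j)] with ω hω
      choose K hK using hω
      refine tendsto_const_nhds.congr' ?_
      filter_upwards [eventually_ge_atTop (Finset.univ.sup K)] with L hL
      have hKL : ∀ j, ∀ a ∈ indices Z (B j) ω, a.1 < L := fun j a ha =>
        (hK j a ha).trans_le ((Finset.le_sup (Finset.mem_univ j)).trans hL)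
      simp only [hh, ← Complex.exp_sum, ← Finset.sum_mul, ← Complex.ofReal_sum]
      congr 3
      rw [Finset.sum_congr rfl fun j _ => ncard_indices (hKL j) (t j), Finset.sum_comm]
      refine Finset.sum_congr rfl fun k _ => ?_
      rw [Finset.sum_comm]
  exact tendsto_nhds_unique hlim2 hlim1

lemma charFun_ncard (hZ : IsPoissonSample c q P Z) {B : Set X} (hB : MeasurableSet B)
    (hfin : Measure.sum (fun k => c k • q k) B ≠ ⊤) (t : ℝ) :
    charFun (P.map fun ω => ((indices Z B ω).ncard : ℝ)) t =
      Complex.exp ((Measure.sum (fun k => c k • q k)).real B *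
        (Complex.exp (t * Complex.I) - 1)) := by
  have h := hZ.integral_exp_ncard (ι := Unit) (B := fun _ => B) (fun _ => hB)
    (fun i j hij => absurd (Subsingleton.elim i j) hij) (fun _ => hfin) fun _ => t
  simp only [Finset.univ_unique, Finset.sum_singleton, Finset.prod_singleton] at h
  rw [← h, charFun_apply, integral_map (hZ.measurable_ncard_indices hB).aemeasurable (by fun_prop)]
  simp [mul_comm]

lemma hasLaw_ncard (hZ : IsPoissonSample c q P Z) {B : Set X} (hB : MeasurableSet B)
    (hfin : Measure.sum (fun k => c k • q k) B ≠ ⊤) :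
    HasLaw (fun ω => ((indices Z B ω).ncard : ℝ))
      ((poissonMeasure (Measure.sum (fun k => c k • q k) B).toNNReal).map (fun n : ℕ => (n : ℝ)))
      P where
  aemeasurable := (hZ.measurable_ncard_indices hB).aemeasurable
  map_eq := by
    have : IsProbabilityMeasure (P.map fun ω => ((indices Z B ω).ncard : ℝ)) :=
      Measure.isProbabilityMeasure_map (hZ.measurable_ncard_indices hB).aemeasurable
    refine Measure.ext_of_charFun ?_
    ext t
    rw [hZ.charFun_ncard hB hfin, charFun_map_cast_poissonMeasure]
    rfl

lemma iIndepFun_ncard (hZ : IsPoissonSample c q P Z) (hB : ∀ j, MeasurableSet (B j))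
    (hdisj : Pairwise fun i j => Disjoint (B i) (B j))
    (hfin : ∀ j, Measure.sum (fun k => c k • q k) (B j) ≠ ⊤) :
    iIndepFun (fun j ω => ((indices Z (B j) ω).ncard : ℝ)) P := by
  rw [iIndepFun_iff_charFun_pi fun j => (hZ.measurable_ncard_indices (hB j)).aemeasurable]
  intro t
  have hm : Measurable fun ω => WithLp.toLp 2 fun j => ((indices Z (B j) ω).ncard : ℝ) :=
    (WithLp.measurable_toLp 2 _).comp
      (measurable_pi_lambda _ fun j => hZ.measurable_ncard_indices (hB j))
  simp only [hZ.charFun_ncard (hB _) (hfin _)]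
  rw [← hZ.integral_exp_ncard hB hdisj hfin, charFun_apply, integral_map hm.aemeasurable
    (by fun_prop)]
  simp [PiLp.inner_apply, mul_comm]

end IsPoissonSample

/-! ### Existence of Poisson point processes -/

/-- The probability that a Poisson variable is at most `n` vanishes as its mean goes to infinity. -/
lemma tendsto_poissonMeasure_Iic (n : ℕ) :
    Tendsto (fun r : ℝ≥0 => poissonMeasure r (Set.Iic n)) atTop (𝓝 0) := by
  have h1 : ∀ r : ℝ≥0, poissonMeasure r (Set.Iic n) =
      ∑ k ∈ Finset.Iic n, ENNReal.ofReal (Real.exp (-r) * r ^ k / k.factorial) := by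
    intro r
    rw [← Finset.coe_Iic, ← sum_measure_singleton]
    simp only [poissonMeasure_singleton]
  simp only [h1]
  rw [← Finset.sum_const_zero (s := Finset.Iic n)]
  refine tendsto_finsetSum _ fun k _ => ?_
  rw [← ENNReal.ofReal_zero]
  refine ENNReal.tendsto_ofReal ?_
  have h2 := ((Real.tendsto_pow_mul_exp_neg_atTop_nhds_zero k).comp
    (NNReal.tendsto_coe_atTop.2 tendsto_id)).div_const (k.factorial : ℝ)
  rw [zero_div] at h2
  refine h2.congr fun r => ?_
  simp [mul_comm]

namespace IsPoissonSample

variable {X : Type*} [MeasurableSpace X] {Ω : Type*} [MeasurableSpace Ω] {c : ℕ → ℝ≥0}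
  {q : ℕ → Measure X} {P : Measure Ω} {Z : ℕ → Ω → ℕ × (ℕ → X)}

lemma measurable_point (hZ : IsPoissonSample c q P Z) (k i : ℕ) :
    Measurable fun ω => (Z k ω).2 i :=
  (measurable_pi_apply i).comp (hZ.measurable k).snd

variable [∀ k, IsProbabilityMeasure (q k)]

lemma map_snd (hZ : IsPoissonSample c q P Z) (k : ℕ) :
    P.map (fun ω => (Z k ω).2) = Measure.infinitePi fun _ : ℕ => q k := by
  have h := Measure.map_map (μ := P) measurable_snd (hZ.measurable k)
  rw [hZ.law k, Measure.map_snd_prod, measure_univ, one_smul] at h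
  exact h.symm

lemma map_point (hZ : IsPoissonSample c q P Z) (k i : ℕ) :
    P.map (fun ω => (Z k ω).2 i) = q k := by
  have h := Measure.map_map (μ := P) (measurable_pi_apply i) (hZ.measurable k).snd
  rw [hZ.map_snd, Measure.infinitePi_map_eval] at h
  exact h.symm

variable [IsProbabilityMeasure P]

lemma ae_encard_eq (hZ : IsPoissonSample c q P Z) {B : Set X} (hB : MeasurableSet B)
    (hfin : Measure.sum (fun k => c k • q k) B ≠ ⊤) :
    ∀ᵐ ω ∂P, (indices Z B ω).encard = ((⌊((indices Z B ω).ncard : ℝ)⌋₊ : ℕ) : ℕ∞) := by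
  filter_upwards [hZ.ae_exists_bound hB hfin] with ω ⟨K, hK⟩
  rw [Nat.floor_natCast, (finite_indices hK).cast_ncard_eq]

lemma hasLaw_encard (hZ : IsPoissonSample c q P Z) {B : Set X} (hB : MeasurableSet B)
    (hfin : Measure.sum (fun k => c k • q k) B ≠ ⊤) :
    HasLaw (fun ω => (indices Z B ω).encard)
      ((poissonMeasure (Measure.sum (fun k => c k • q k) B).toNNReal).map (fun n : ℕ => (n : ℕ∞)))
      P := by
  have hf : Measurable fun x : ℝ => ((⌊x⌋₊ : ℕ) : ℕ∞) :=
    (Measurable.of_discrete (f := fun n : ℕ => (n : ℕ∞))).comp Nat.measurable_floor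
  refine HasLaw.congr (X := fun ω => ((⌊((indices Z B ω).ncard : ℝ)⌋₊ : ℕ) : ℕ∞)) ?_
    (hZ.ae_encard_eq hB hfin)
  refine ⟨(hf.comp (hZ.measurable_ncard_indices hB)).aemeasurable, ?_⟩
  have h := (hZ.hasLaw_ncard hB hfin).map_eq
  change P.map ((fun x : ℝ => ((⌊x⌋₊ : ℕ) : ℕ∞)) ∘ fun ω => ((indices Z B ω).ncard : ℝ)) = _
  rw [← Measure.map_map hf (hZ.measurable_ncard_indices hB), h,
    Measure.map_map hf Measurable.of_discrete]
  congr 1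
  ext n
  simp

/-- A set of infinite intensity contains infinitely many points. -/
lemma ae_encard_eq_top (hZ : IsPoissonSample c q P Z)
    [SigmaFinite (Measure.sum fun k => c k • q k)] {B : Set X} (hB : MeasurableSet B)
    (htop : Measure.sum (fun k => c k • q k) B = ⊤) :
    ∀ᵐ ω ∂P, (indices Z B ω).encard = ⊤ := by
  set μ := Measure.sum fun k => c k • q k with hμ
  have hn : ∀ n : ℕ, P {ω | (indices Z B ω).encard ≤ n} = 0 := by
    intro n
    choose C hCm hCB hC hCfin using fun m : ℕ =>
      Measure.exists_subset_measure_lt_top (μ := μ) (r := (m : ℝ≥0∞)) hB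
        (by rw [htop]; exact ENNReal.natCast_lt_top m)
    have hlim : Tendsto (fun m => (μ (C m)).toNNReal) atTop atTop := by
      refine tendsto_atTop_mono (f := fun m : ℕ => (m : ℝ≥0)) (fun m => ?_)
        tendsto_natCast_atTop_atTop
      rw [← ENNReal.coe_le_coe, ENNReal.coe_toNNReal (hCfin m).ne]
      exact_mod_cast (hC m).le
    refine le_antisymm (ge_of_tendsto' ((tendsto_poissonMeasure_Iic n).comp hlim) fun m => ?_)
      bot_le
    have hl := hZ.hasLaw_encard (hCm m) (hCfin m).ne
    have h1 : P {ω | (indices Z (C m) ω).encard ≤ n} =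
        poissonMeasure (μ (C m)).toNNReal (Set.Iic n) := by
      rw [hl.measure_eq (p := fun x => x ≤ (n : ℕ∞)) (Set.to_countable _).measurableSet,
        Measure.map_apply Measurable.of_discrete (Set.to_countable _).measurableSet]
      congr 1
      ext k
      simp
    rw [Function.comp_apply, ← h1]
    refine measure_mono fun ω hω => le_trans (Set.encard_le_encard ?_) hω
    exact fun a ha => ⟨ha.1, hCB m ha.2⟩
  filter_upwards [ae_all_iff.2 fun n => measure_eq_zero_iff_ae_notMem.1 (hn n)] with ω hω
  rw [ENat.eq_top_iff_forall_gt]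
  exact fun n => not_le.1 (hω n)

/-- The numbers of points in disjoint sets are independent, those with infinite mean being almost
surely constant. -/
lemma iIndepFun_encard (hZ : IsPoissonSample c q P Z)
    [SigmaFinite (Measure.sum fun k => c k • q k)] {ι : Type*} [Fintype ι] {B : ι → Set X}
    (hB : ∀ j, MeasurableSet (B j)) (hdisj : Pairwise fun i j => Disjoint (B i) (B j)) :
    iIndepFun (fun j ω => (indices Z (B j) ω).encard) P := by
  classical
  set μ := Measure.sum fun k => c k • q k with hμ
  -- the counts with finite mean are functions of those of `B'`, the others are constant
  set B' : ι → Set X := fun j => if μ (B j) = ⊤ then ∅ else B j with hB'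
  have hB'B : ∀ j, B' j ⊆ B j := fun j => by simp only [hB']; split_ifs <;> simp
  have hB'm : ∀ j, MeasurableSet (B' j) := fun j => by
    simp only [hB']; split_ifs
    · exact MeasurableSet.empty
    · exact hB j
  have hB'fin : ∀ j, μ (B' j) ≠ ⊤ := fun j => by
    simp only [hB']; split_ifs with h
    · simp
    · exact h
  have hi := (hZ.iIndepFun_ncard hB'm
    (fun i j hij => (hdisj hij).mono (hB'B i) (hB'B j)) hB'fin).comp
    (fun j x => if μ (B j) = ⊤ then (⊤ : ℕ∞) else ((⌊x⌋₊ : ℕ) : ℕ∞)) (fun j => by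
      split_ifs
      · exact measurable_const
      · exact (Measurable.of_discrete (f := fun n : ℕ => (n : ℕ∞))).comp Nat.measurable_floor)
  refine hi.congr fun j => ?_
  by_cases h : μ (B j) = ⊤
  · filter_upwards [hZ.ae_encard_eq_top (hB j) h] with ω hω
    simp [h, hω]
  · filter_upwards [hZ.ae_encard_eq (hB j) h] with ω hω
    rw [hω]
    simp [h, hB']

lemma iIndepFun_point (hZ : IsPoissonSample c q P Z) :
    iIndepFun (fun (a : ℕ × ℕ) ω => (Z a.1 ω).2 a.2) P := by
  refine iIndepFun_uncurry' (X := fun k i ω => (Z k ω).2 i) (fun k i => hZ.measurable_point k i)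
    (hZ.indep.comp (fun _ z => z.2) fun _ => measurable_snd) fun k => ?_
  rw [iIndepFun_iff_map_fun_eq_infinitePi_map fun i => hZ.measurable_point k i]
  simp only [hZ.map_point]
  exact hZ.map_snd k

/-- Almost surely, the points of the sample are pairwise distinct, if their laws are diffuse. -/
lemma ae_injective [MeasurableEq X] [∀ k, NullSingletonClass (q k)] (hZ : IsPoissonSample c q P Z) :
    ∀ᵐ ω ∂P, Function.Injective fun a : ℕ × ℕ => (Z a.1 ω).2 a.2 := by
  have h : ∀ a b : ℕ × ℕ, a ≠ b → ∀ᵐ ω ∂P, (Z a.1 ω).2 a.2 ≠ (Z b.1 ω).2 b.2 := by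
    intro a b hab
    have hi := (hZ.iIndepFun_point.indepFun hab).map_prod_eq_prod_map_map
      (hZ.measurable_point _ _).aemeasurable (hZ.measurable_point _ _).aemeasurable
    rw [hZ.map_point, hZ.map_point] at hi
    have h0 : ((q a.1).prod (q b.1)) (Set.diagonal X) = 0 := by
      rw [Measure.prod_apply measurableSet_diagonal]
      have : ∀ x : X, Prod.mk x ⁻¹' Set.diagonal X = {x} := fun x => by
        ext y; simp [eq_comm]
      simp [this]
    rw [← hi, Measure.map_apply ((hZ.measurable_point _ _).prodMk (hZ.measurable_point _ _))
      measurableSet_diagonal] at h0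
    exact measure_eq_zero_iff_ae_notMem.1 h0
  filter_upwards [ae_all_iff.2 fun a => ae_all_iff.2 fun b => ae_all_iff.2 (h a b)] with ω hω a b hab
  by_contra hne
  exact hω a b hne hab

end IsPoissonSample

/-- Existence of the Poisson point process with a given diffuse intensity. -/
theorem exists_isPoissonPointProcess {X : Type} [MeasurableSpace X] [MeasurableEq X]
    (μ : Measure X) [SigmaFinite μ] [NullSingletonClass μ] (hμ : μ ≠ 0) :
    ∃ (Ω : Type u) (_ : MeasurableSpace Ω) (P : Measure Ω) (_ : IsProbabilityMeasure P)
      (ξ : Ω → Set X), IsPoissonPointProcess μ P ξ := by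
  classical
  -- the intensity is a sum of multiples of diffuse probability measures
  obtain ⟨c, q, hq, hqa, hsum⟩ : ∃ (c : ℕ → ℝ≥0) (q : ℕ → Measure X),
      (∀ k, IsProbabilityMeasure (q k)) ∧ (∀ k, NullSingletonClass (q k)) ∧
        Measure.sum (fun k => c k • q k) = μ := by
    set s := sfiniteSeq μ with hs
    have hsa : ∀ k, NullSingletonClass (s k) := fun k =>
      ⟨fun x => le_antisymm ((sfiniteSeq_le μ k {x}).trans (measure_singleton x).le) bot_le⟩
    obtain ⟨k₀, hk₀⟩ : ∃ k, s k ≠ 0 := by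
      by_contra! h
      refine hμ ?_
      rw [← sum_sfiniteSeq μ, ← hs]
      ext A hA
      rw [Measure.sum_apply _ hA]
      simp [h]
    have hprob : ∀ k, s k ≠ 0 → IsProbabilityMeasure ((s k Set.univ)⁻¹ • s k) := fun k hk =>
      haveI : NeZero (s k) := ⟨hk⟩
      isProbabilityMeasureSMul
    -- a vanishing term gets weight zero and the arbitrary diffuse law of the term `k₀`
    refine ⟨fun k => (s k Set.univ).toNNReal, fun k => if s k = 0 then (s k₀ Set.univ)⁻¹ • s k₀
      else (s k Set.univ)⁻¹ • s k, fun k => ?_, fun k => ?_, ?_⟩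
    · simp only
      split_ifs with h
      · exact hprob _ hk₀
      · exact hprob _ h
    · simp only
      split_ifs with h
      · exact ⟨fun x => by simp⟩
      · exact ⟨fun x => by simp⟩
    · rw [← sum_sfiniteSeq μ, ← hs]
      congr 1
      ext k A hA
      by_cases h : s k = 0
      · simp [h]
      · have h0 : s k Set.univ ≠ 0 := by simpa using h
        simp only [h, if_false, Measure.smul_apply, ENNReal.smul_def, smul_eq_mul]
        rw [ENNReal.coe_toNNReal (measure_ne_top _ _), ← mul_assoc,
          ENNReal.mul_inv_cancel h0 (measure_ne_top _ _), one_mul]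
  -- indexing by `ULift ℕ` places the sample space in the required universe
  set P : Measure (ULift.{u} ℕ → ℕ × (ℕ → X)) := Measure.infinitePi fun k =>
    (poissonMeasure (c k.down)).prod (Measure.infinitePi fun _ : ℕ => q k.down) with hP
  set Z : ℕ → (ULift.{u} ℕ → ℕ × (ℕ → X)) → ℕ × (ℕ → X) := fun k ω => ω ⟨k⟩ with hZdef
  have hZ : IsPoissonSample c q P Z := by
    refine ⟨fun k => measurable_pi_apply _, ?_, fun k => ?_⟩
    · exact (iIndepFun_infinitePi (X := fun _ z => z) fun _ => measurable_id).precomp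
        ULift.up_injective
    · exact Measure.infinitePi_map_eval _ _
  -- off a measurable null set, the points are distinct
  obtain ⟨G, hGinj, hGm, hG⟩ : ∃ G : Set (ULift.{u} ℕ → ℕ × (ℕ → X)),
      (∀ ω ∈ G, Function.Injective fun a : ℕ × ℕ => (Z a.1 ω).2 a.2) ∧ MeasurableSet G ∧
        ∀ᵐ ω ∂P, ω ∈ G := by
    obtain ⟨G, hGsub, hGm, hG⟩ := exists_measurable_superset_of_null hZ.ae_injective
    refine ⟨Gᶜ, fun ω hω => ?_, hGm.compl, measure_eq_zero_iff_ae_notMem.1 hG⟩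
    by_contra h
    exact hω (hGsub h)
  set ξ : (ULift.{u} ℕ → ℕ × (ℕ → X)) → Set X := fun ω =>
    if ω ∈ G then (fun a : ℕ × ℕ => (Z a.1 ω).2 a.2) '' {a | a.2 < (Z a.1 ω).1} else ∅ with hξ
  have hcount : ∀ (B : Set X) (ω), (ξ ω ∩ B).encard =
      if ω ∈ G then (IsPoissonSample.indices Z B ω).encard else 0 := by
    intro B ω
    by_cases hω : ω ∈ G
    · have : ξ ω ∩ B = (fun a : ℕ × ℕ => (Z a.1 ω).2 a.2) '' IsPoissonSample.indices Z B ω := by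
        simp only [hξ, hω, if_true]
        ext x
        constructor
        · rintro ⟨⟨a, ha, rfl⟩, hx⟩
          exact ⟨a, ⟨ha, hx⟩, rfl⟩
        · rintro ⟨a, ⟨ha, hx⟩, rfl⟩
          exact ⟨⟨a, ha, rfl⟩, hx⟩
      rw [this, (hGinj ω hω).encard_image, if_pos hω]
    · simp [hξ, hω]
  have hae : ∀ B : Set X, (fun ω => (ξ ω ∩ B).encard) =ᵐ[P]
      fun ω => (IsPoissonSample.indices Z B ω).encard := fun B => by
    filter_upwards [hG] with ω hω
    rw [hcount, if_pos hω]
  refine ⟨_, inferInstance, P, inferInstance, ξ, fun B hB => ?_, fun B hB hfin => ?_,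
    fun n B hB hdisj => ?_⟩
  · simp only [hcount]
    exact Measurable.ite hGm (hZ.measurable_encard_indices hB) measurable_const
  · have h := hZ.hasLaw_encard hB (by rw [hsum]; exact hfin.ne)
    rw [hsum] at h
    exact h.congr (hae B)
  · have : SigmaFinite (Measure.sum fun k => c k • q k) := by rw [hsum]; infer_instance
    exact (hZ.iIndepFun_encard hB hdisj).congr fun j => (hae (B j)).symm

/-! ### Covering of the space when the moment is infinite -/

lemma IsPoissonPointProcess.measure_void_eq_zero {X : Type*} [MeasurableSpace X] {Ω : Type*}
    [MeasurableSpace Ω] {μ : Measure X} [SigmaFinite μ] {P : Measure Ω} {ξ : Ω → Set X}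
    (h : IsPoissonPointProcess μ P ξ) {B : Set X} (hB : MeasurableSet B) (htop : μ B = ⊤) :
    P {ω | ξ ω ∩ B = ∅} = 0 := by
  have hlim : Tendsto (fun m : ℕ => ENNReal.ofReal (Real.exp (-(m : ℝ)))) atTop (𝓝 0) := by
    rw [← ENNReal.ofReal_zero]
    exact ENNReal.tendsto_ofReal (Real.tendsto_exp_neg_atTop_nhds_zero.comp
      tendsto_natCast_atTop_atTop)
  refine le_antisymm (ge_of_tendsto' hlim fun m => ?_) bot_le
  obtain ⟨C, hCm, hCB, hC, hCfin⟩ := Measure.exists_subset_measure_lt_top (μ := μ)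
    (r := (m : ℝ≥0∞)) hB (by rw [htop]; exact ENNReal.natCast_lt_top m)
  have hsub : {ω | ξ ω ∩ B = ∅} ⊆ {ω | ξ ω ∩ C = ∅} := fun ω hω =>
    Set.subset_eq_empty (Set.inter_subset_inter_right _ hCB) hω
  refine (measure_mono hsub).trans ?_
  rw [h.measure_void hCm hCfin]
  refine ENNReal.ofReal_le_ofReal (Real.exp_le_exp.2 (neg_le_neg ?_))
  rw [← ENNReal.toReal_natCast]
  exact ENNReal.toReal_mono hCfin.ne hC.le

namespace BooleanModel

variable {d : ℕ}

/-- The pairs `(c, r)` such that `B(c, r)` contains the closed ball of radius `a` around `0`. -/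
def coveringBalls (d : ℕ) (a : ℝ) : Set (Space d × Radius) := {c | dist c.1 0 + a < c.2}

lemma measurableSet_coveringBalls (a : ℝ) : MeasurableSet (coveringBalls d a) :=
  measurableSet_lt (by fun_prop) (by fun_prop)

lemma momentTail_eq_top {ν : Measure Radius} [IsProbabilityMeasure ν]
    (hν : ¬ Integrable (fun r : Radius => (r : ℝ) ^ d) ν) (a : ℝ) : momentTail d ν a = ⊤ := by
  by_contra hfin
  have hm : MeasurableSet {r : Radius | a ≤ r} := measurableSet_le (by fun_prop) (by fun_prop)
  refine hν ⟨by fun_prop, ?_⟩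
  rw [hasFiniteIntegral_iff_ofReal (ae_of_all _ fun r => pow_nonneg r.2.le d),
    ← lintegral_add_compl _ hm]
  refine ENNReal.add_lt_top.2 ⟨lt_top_iff_ne_top.2 hfin, ?_⟩
  refine lt_of_le_of_lt (setLIntegral_mono (g := fun _ => ENNReal.ofReal (a ^ d)) measurable_const
    fun r hr => ?_) ?_
  · exact ENNReal.ofReal_le_ofReal (pow_le_pow_left₀ r.2.le (lt_of_not_ge (a := (r : ℝ)) (b := a) hr).le d)
  · rw [setLIntegral_const]
    finiteness

lemma intensity_coveringBalls {lam : ℝ} (hlam : 0 < lam) {ν : Measure Radius}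
    [IsProbabilityMeasure ν] (hν : ¬ Integrable (fun r : Radius => (r : ℝ) ^ d) ν) (a : ℝ) :
    intensity d lam ν (coveringBalls d a) = ⊤ := by
  have hm : MeasurableSet {r : Radius | 2 * a ≤ r} :=
    measurableSet_le (by fun_prop) (by fun_prop)
  have hv : ENNReal.ofReal ((1 / 2) ^ d) * volume (Metric.ball (0 : Space d) 1) ≠ 0 :=
    mul_ne_zero (by simp) (Metric.measure_ball_pos _ _ one_pos).ne'
  rw [intensity_eq_lintegral _ _ (measurableSet_coveringBalls a), eq_top_iff]
  calc (⊤ : ℝ≥0∞) = ENNReal.ofReal lam * (ENNReal.ofReal ((1 / 2) ^ d) *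
        volume (Metric.ball (0 : Space d) 1) * momentTail d ν (2 * a)) := by
        rw [momentTail_eq_top hν, ENNReal.mul_top hv, ENNReal.mul_top (by simpa using hlam)]
    _ ≤ _ := by
        rw [momentTail, ← lintegral_indicator hm,
          ← lintegral_const_mul _ (Measurable.indicator (by fun_prop) hm)]
        gcongr with r
        by_cases hr : 2 * a ≤ r
        · have h0 : (0 : ℝ) < 1 / 2 * r := mul_pos (by norm_num) r.2
          have hs : Metric.ball (0 : Space d) (1 / 2 * r) ⊆
              {c : Space d | (c, r) ∈ coveringBalls d a} := fun c hc => by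
            rw [Metric.mem_ball] at hc
            change dist c 0 + a < r
            linarith
          refine le_trans (le_of_eq ?_) (measure_mono hs)
          rw [Measure.addHaar_ball_of_pos _ _ h0, Set.indicator_of_mem (by exact hr),
            finrank_euclideanSpace_fin, mul_pow, ENNReal.ofReal_mul (by positivity)]
          ring
        · rw [Set.indicator_of_notMem (by exact hr)]
          simp

/-- If every ball around `0` lies in a single ball of the configuration, the cluster of the origin
is the whole space. -/
lemma percolates_of_nonempty_coveringBalls (hd : 1 ≤ d) {ξ : Set (Space d × Radius)}
    (h : ∀ n : ℕ, (ξ ∩ coveringBalls d n).Nonempty) : Percolates ξ := by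
  have : Nonempty (Fin d) := ⟨⟨0, hd⟩⟩
  have hocc : occupied ξ = Set.univ := by
    refine Set.eq_univ_of_forall fun x => ?_
    obtain ⟨n, hn⟩ := exists_nat_gt (dist x 0)
    obtain ⟨c, hc, hcn⟩ := h n
    refine Set.mem_iUnion₂.2 ⟨c, hc, ?_⟩
    change dist c.1 0 + n < c.2 at hcn
    rw [Metric.mem_ball]
    linarith [dist_triangle_right x c.1 0]
  rw [Percolates, cluster, hocc, connectedComponentIn_univ,
    PreconnectedSpace.connectedComponent_eq_univ]
  exact NormedSpace.unbounded_univ ℝ _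

/-- If the `d`-th moment is infinite, the balls cover the whole space at every density. -/
theorem not_percolationNull_of_not_integrable (hd : 1 ≤ d) {lam : ℝ} (hlam : 0 < lam)
    {ν : Measure Radius} [IsProbabilityMeasure ν]
    (hν : ¬ Integrable (fun r : Radius => (r : ℝ) ^ d) ν) : ¬ PercolationNull.{u} d lam ν := by
  intro hnull
  have : Nonempty (Fin d) := ⟨⟨0, hd⟩⟩
  have hsf : SigmaFinite (intensity d lam ν) := by
    have : SigmaFinite (lam.toNNReal • (volume : Measure (Space d))) := inferInstance
    exact inferInstanceAs (SigmaFinite ((lam.toNNReal • (volume : Measure (Space d))).prod ν))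
  have hna : NullSingletonClass (intensity d lam ν) := by
    refine ⟨fun c => ?_⟩
    rw [← Set.singleton_prod_singleton, intensity, Measure.prod_prod]
    simp
  have hne : intensity d lam ν ≠ 0 := fun h0 => by
    have := intensity_coveringBalls hlam hν 0
    simp [h0] at this
  obtain ⟨Ω, _, P, _, ξ, hξ⟩ := exists_isPoissonPointProcess.{u} (intensity d lam ν) hne
  have hae : ∀ᵐ ω ∂P, Percolates (ξ ω) := by
    have h0 := fun n : ℕ => measure_eq_zero_iff_ae_notMem.1 (hξ.measure_void_eq_zero
      (measurableSet_coveringBalls n) (intensity_coveringBalls hlam hν n))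
    filter_upwards [ae_all_iff.2 h0] with ω hω
    exact percolates_of_nonempty_coveringBalls hd fun n => Set.nonempty_iff_ne_empty.2 (hω n)
  have h1 : P Set.univ = 0 := by
    rw [← measure_eq_measure_of_null_sdiff (Set.subset_univ {ω | Percolates (ξ ω)})]
    · exact hnull Ω P ξ hξ
    · rw [← Set.compl_eq_univ_sdiff]; exact hae
  simp at h1

end BooleanModel

theorem theorem2p1 (d : ℕ) (hd : 1 ≤ d) :
    (∀ (ν : Measure BooleanModel.Radius) [IsProbabilityMeasure ν],
      Integrable (fun r : BooleanModel.Radius => (r : ℝ) ^ d) ν ↔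
        ∃ lam₀ : ℝ, 0 < lam₀ ∧ ∀ lam : ℝ, 0 < lam → lam < lam₀ →
          BooleanModel.PercolationNull.{u} d lam ν) ∧
    ∃ C : ℝ, 0 < C ∧ ∀ (ν : Measure BooleanModel.Radius) [IsProbabilityMeasure ν],
      Integrable (fun r : BooleanModel.Radius => (r : ℝ) ^ d) ν →
        ∀ lam : ℝ, 0 < lam → lam < C * (∫ r : BooleanModel.Radius, (r : ℝ) ^ d ∂ν)⁻¹ →
          BooleanModel.PercolationNull.{u} d lam ν := by
  obtain ⟨C, hC, h⟩ := BooleanModel.exists_percolationNull_of_integrable.{u} hd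
  refine ⟨fun ν _ => ⟨fun hν => ?_, fun ⟨lam₀, h₀, hlam₀⟩ => ?_⟩, C, hC, h⟩
  · have hpos : 0 < ∫ r : BooleanModel.Radius, (r : ℝ) ^ d ∂ν := by
      have hr : ∀ r : BooleanModel.Radius, 0 < (r : ℝ) ^ d := fun r => pow_pos r.2 d
      rw [integral_pos_iff_support_of_nonneg (fun r => (hr r).le) hν,
        Set.eq_univ_of_forall fun r => Function.mem_support.2 (hr r).ne', measure_univ]
      exact one_pos
    exact ⟨_, mul_pos hC (inv_pos.2 hpos), h ν hν⟩
  · by_contra hν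
    exact BooleanModel.not_percolationNull_of_not_integrable hd (half_pos h₀) hν
      (hlam₀ _ (half_pos h₀) (half_lt_self h₀))
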